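/- **Setting.** Let $D\ge 1$, $1\le p\le\infty$, and let $\Gamma$ be a set of sites with a metric such that distinct sites have distance at least $1$, together with an isometric embedding of $\Gamma$ into $\mathbb R^D$ with the $\ell^p$-norm (for instance $\mathbb Z^D$ with its graph distance, $p=1$, or any graph isometrically embedded in Euclidean space). Each site carries $\mathbb C^d$, $d\ge1$; for finite $\Lambda\subset\Gamma$ put $\mathcal H_\Lambda=\bigotimes_{x\in\Lambda}\mathbb C^d$ and $H_\Lambda=\sum_{X\subseteq\Lambda}h(X)$, where $h(X)$ acts on $\mathcal H_X$ (and as the identity elsewhere). Let $P_\Lambda$ be the orthogonal projector onto the eigenspace of the smallest eigenvalue of $H_\Lambda$, and let the spectral gap $\lambda_\Lambda$ be the difference of the two lowest distinct eigenvalues of $H_\Lambda$ ($+\infty$ if there is only one). Assume that every $h(X)$ is an orthogonal projection with smallest eigenvalue $0$, that $h(X)=0$ if $\operatorname{diam}X>r$ (finite range $r>0$), and that $h(X)P_\Lambda=0$ for all finite $X\subseteq\Lambda$ (frustration freeness). For finite $A,B\subset\Gamma$ let $\delta(A,B)=\|(P_A-P_{A\cup B})(P_B-P_{A\cup B})\|$,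 and call $l=\operatorname{dist}\big((A\cup B)\setminus A,(A\cup B)\setminus B\big)$ the size of the overlap of $A$ and $B$. Let $l_k=(3/2)^{k/D}$, and let $\mathcal F_k$ be the collection of finite $\Lambda\subset\Gamma$ contained, up to translations and permutations of the coordinates, in $[0,l_{k+1}]\times\dots\times[0,l_{k+D}]$. For $\Lambda\in\mathcal F_k\setminus\mathcal F_{k-1}$, an $s$-decomposition of $\Lambda$ is a family of $s$ distinct pairs $(A_i,B_i)$ of non-empty sets such that $\Lambda=A_i\cup B_i$, $A_i,B_i\in\mathcal F_{k-1}$, $\operatorname{dist}(\Lambda\setminus A_i,\Lambda\setminus B_i)\ge \frac{l_k}{8s}-2$, and $A_i\cap B_i\cap A_j\cap B_j=\emptyset$ for $i\ne j$. Call a non-decreasing sequence of positive integers $(s_k)$ admissible if $\sum_k 1/s_k<\infty$ and $\sum_k s_k/l_k<\infty$, and let $\delta_k$ be the supremum of $\delta(A_i,B_i)$ over all $i$ and all $s_k$-decompositions of all $\Lambda\in\mathcal F_k\setminus\mathcal F_{k-1}$. * **Condition A with $\delta(\cdot)$:** $\delta(l)>0$ and $\delta(l)\le c\,\alpha^{l}$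 for all $l>0$, for some $c>0$, $0<\alpha<1$, and $\delta(A,B)\le\delta(l)$ for all finite $A,B$ whose overlap has finite size $l>r$. * **Condition B with $\delta(\cdot)$:** the same with $\delta(l)\le c\,l^{-\alpha}$ for some $c,\alpha>0$. * **Condition C with $(s_k)$:** $\sum_{k\ge1}\delta_k<\infty$. **Theorem.** There is a constant $g>0$, depending only on $\Gamma$ (with its embedding) and $r$, such that the following holds for every $d$ and every $h$ as above. (a) If $\lambda>0$ and $\inf_k\inf_{\Lambda\in\mathcal F_k}\lambda_\Lambda\ge\lambda$, then Condition A holds with $\delta(l)=(1+\lambda/g^2)^{-l/2}$. (b) Suppose in addition that $\inf_{\Lambda\in\mathcal F_k}\lambda_\Lambda>0$ for each single $k$. Then the following are equivalent: 1. there is $\lambda>0$ with $\inf_k\inf_{\Lambda\in\mathcal F_k}\lambda_\Lambda\ge\lambda$; 2. there is $\lambda>0$ such that Condition A holds with $\delta(l)=(1+\lambda/g^2)^{-l/2}$; 3. Condition B holds with some $\delta(\cdot)$; 4. Condition C holds with some admissible $(s_k)$; equivalently, Condition C holds with every admissible $(s_k)$. -/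

import Mathlib

open scoped ENNReal

noncomputable section

namespace SpinLattice

/-! ### Quantum spin systems on a set of sites `Γ`, with local dimension `d` -/

/-- Configurations of a finite region, i.e. labels of the product basis. -/
abbrev Config {Γ : Type*} (d : ℕ) (X : Finset Γ) : Type _ := {x // x ∈ X} → Fin d

/-- The Hilbert space `⊗_{x ∈ X} ℂ^d`, realised as `ℓ²` over the product basis. -/
abbrev HilbertSpace {Γ : Type*} (d : ℕ) (X : Finset Γ) : Type _ :=
  EuclideanSpace ℂ (Config d X)

/-- The algebra of observables of a finite region, as matrices in the product basis. -/
abbrev Observable {Γ : Type*} (d : ℕ) (X : Finset Γ) : Type _ :=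
  Matrix (Config d X) (Config d X) ℂ

/-- An interaction assigns to every finite region an observable of this region. -/
abbrev Interaction (Γ : Type*) (d : ℕ) : Type _ := (X : Finset Γ) → Observable d X

section Observables

open scoped Classical

variable {Γ : Type*} {d : ℕ}

/-- The bounded operator on the Hilbert space defined by an observable. -/
def toOp {X : Finset Γ} (M : Observable d X) : HilbertSpace d X →L[ℂ] HilbertSpace d X :=
  Matrix.toEuclideanCLM (n := Config d X) (𝕜 := ℂ) M

/-- The embedding `M ↦ M ⊗ 1` of the observables of `X` into those of a larger region `Λ`. -/
def extend {X Λ : Finset Γ} (hX : X ⊆ Λ) (M : Observable d X) : Observable d Λ :=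
  Matrix.of fun σ τ =>
    if ∀ x : {x // x ∈ Λ}, (x : Γ) ∉ X → σ x = τ x then
      M (Finset.restrict₂ (π := fun _ => Fin d) hX σ) (Finset.restrict₂ (π := fun _ => Fin d) hX τ)
    else 0

/-- The real numbers that are eigenvalues of an observable. -/
def eigenvalueSet {X : Finset Γ} (M : Observable d X) : Set ℝ :=
  {μ | Module.End.HasEigenvalue (toOp M : HilbertSpace d X →ₗ[ℂ] HilbertSpace d X) (μ : ℂ)}

/-- The smallest eigenvalue of a Hermitian observable. -/
def groundEnergy {X : Finset Γ} (M : Observable d X) : ℝ := sInf (eigenvalueSet M)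

/-- The orthogonal projector onto the eigenspace of the smallest eigenvalue. -/
def groundProjector {X : Finset Γ} (M : Observable d X) : Observable d X :=
  (Matrix.toEuclideanCLM (n := Config d X) (𝕜 := ℂ)).symm
    (Module.End.eigenspace (toOp M : HilbertSpace d X →ₗ[ℂ] HilbertSpace d X)
      (groundEnergy M : ℂ)).starProjection

/-- The Hamiltonian `H_Λ = ∑_{X ⊆ Λ} h(X)`. -/
def hamiltonian (h : Interaction Γ d) (Λ : Finset Γ) : Observable d Λ :=
  ∑ X ∈ Λ.powerset.attach, extend (Finset.mem_powerset.mp X.2) (h X.1)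

/-- The ground state projector `P_Λ` of `H_Λ`. -/
def groundProj (h : Interaction Γ d) (Λ : Finset Γ) : Observable d Λ :=
  groundProjector (hamiltonian h Λ)

/-- The spectral gap of `H_Λ`: the difference of its two lowest distinct eigenvalues, with the
value `∞` if there is only one eigenvalue. -/
def gap (h : Interaction Γ d) (Λ : Finset Γ) : ℝ≥0∞ :=
  ⨅ μ ∈ eigenvalueSet (hamiltonian h Λ) \ {groundEnergy (hamiltonian h Λ)},
    ENNReal.ofReal (μ - groundEnergy (hamiltonian h Λ))

/-- `δ(A, B) = ‖(P_A - P_{A ∪ B}) (P_B - P_{A ∪ B})‖`. -/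
def overlap (h : Interaction Γ d) (A B : Finset Γ) : ℝ :=
  ‖toOp ((extend (Finset.subset_union_left (s₁ := A) (s₂ := B)) (groundProj h A)
        - groundProj h (A ∪ B)) *
      (extend (Finset.subset_union_right (s₁ := A) (s₂ := B)) (groundProj h B)
        - groundProj h (A ∪ B)))‖

end Observables

section Geometry

open scoped Classical

variable {Γ : Type*} [MetricSpace Γ] {d : ℕ}

/-- Frustration free local Hamiltonians of range `r` made of orthogonal projections, with the
ground state energy of every interaction term normalised to zero. -/
structure IsFrustrationFree (r : ℝ) (h : Interaction Γ d) : Prop where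
  projection : ∀ X : Finset Γ, IsStarProjection (h X)
  finite_range : ∀ X : Finset Γ, r < Metric.diam (X : Set Γ) → h X = 0
  energy_zero : ∀ X : Finset Γ, groundEnergy (h X) = 0
  frustration_free : ∀ (X Λ : Finset Γ) (hX : X ⊆ Λ),
    extend hX (h X) * groundProj h Λ = (groundEnergy (h X) : ℂ) • groundProj h Λ

/-- The distance between two finite regions (`∞` if one of them is empty). -/
def regionDist (S T : Finset Γ) : ℝ≥0∞ := ⨅ x ∈ S, ⨅ y ∈ T, edist x y

/-- The size of the overlap of `A` and `B`: the distance between `(A ∪ B) \ A` and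
`(A ∪ B) \ B`. -/
def overlapSize (A B : Finset Γ) : ℝ≥0∞ := regionDist ((A ∪ B) \ A) ((A ∪ B) \ B)

/-- `δ(A, B) ≤ δ(l)` for all finite `A`, `B` whose overlap has a size `l` exceeding the range. -/
def OverlapBound (r : ℝ) (h : Interaction Γ d) (f : ℝ → ℝ) : Prop :=
  ∀ (A B : Finset Γ) (l : ℝ), r < l → overlapSize A B = ENNReal.ofReal l → overlap h A B ≤ f l

/-- Exponential decay of the overlap, with the decay function `f`. -/
def ConditionA (r : ℝ) (h : Interaction Γ d) (f : ℝ → ℝ) : Prop :=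
  (∀ l, 0 < l → 0 < f l) ∧
  (∃ c α : ℝ, 0 < c ∧ 0 < α ∧ α < 1 ∧ ∀ l, 0 < l → f l ≤ c * α ^ l) ∧
  OverlapBound r h f

/-- Polynomial decay of the overlap, with the decay function `f`. -/
def ConditionB (r : ℝ) (h : Interaction Γ d) (f : ℝ → ℝ) : Prop :=
  (∀ l, 0 < l → 0 < f l) ∧
  (∃ c α : ℝ, 0 < c ∧ 0 < α ∧ ∀ l, 0 < l → f l ≤ c * l ^ (-α)) ∧
  OverlapBound r h f

/-- The length scale `l_k = (3/2)^{k/D}`. -/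
def len (D k : ℕ) : ℝ := (3 / 2 : ℝ) ^ ((k : ℝ) / (D : ℝ))

variable {D : ℕ} {p : ℝ≥0∞}

/-- The class `F_k`: the finite regions that are contained, up to translations and permutations of
the coordinates, in `[0, l_{k+1}] × ⋯ × [0, l_{k+D}]`. Here `ι` gives the positions of the sites
in `ℝ^D`. -/
def regionClass (ι : Γ → PiLp p (fun _ : Fin D => ℝ)) (k : ℕ) : Set (Finset Γ) :=
  {Λ | ∃ (v : Fin D → ℝ) (π : Equiv.Perm (Fin D)), ∀ x ∈ Λ, ∀ i : Fin D,
    v i ≤ ι x i ∧ ι x i ≤ v i + len D (k + ((π i : ℕ) + 1))}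

/-- `s`-decompositions of a region `Λ ∈ F_k \ F_{k-1}` (for `k ≥ 1`): `s` distinct pairs
`(A_i, B_i)` of non-empty sets with the three properties below. -/
structure IsDecomposition (ι : Γ → PiLp p (fun _ : Fin D => ℝ)) (k s : ℕ) (Λ : Finset Γ)
    (A B : Fin s → Finset Γ) : Prop where
  distinct : Function.Injective fun i => (A i, B i)
  nonempty_left : ∀ i, (A i).Nonempty
  nonempty_right : ∀ i, (B i).Nonempty
  union_eq : ∀ i, Λ = A i ∪ B i
  mem_left : ∀ i, A i ∈ regionClass ι (k - 1)
  mem_right : ∀ i, B i ∈ regionClass ι (k - 1)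
  dist_ge : ∀ i, ENNReal.ofReal (len D k / (8 * s) - 2) ≤ regionDist (Λ \ A i) (Λ \ B i)
  overlap_disjoint : ∀ i j, i ≠ j → A i ∩ B i ∩ A j ∩ B j = ∅

/-- `δ_k`: the supremum of `δ(A_i, B_i)` over all `s`-decompositions of all regions in
`F_k \ F_{k-1}` (for `k ≥ 1`). -/
def deltaSup (ι : Γ → PiLp p (fun _ : Fin D => ℝ)) (h : Interaction Γ d) (k s : ℕ) : ℝ≥0∞ :=
  ⨆ Λ ∈ regionClass ι k \ regionClass ι (k - 1),
    ⨆ (A : Fin s → Finset Γ) (B : Fin s → Finset Γ) (_ : IsDecomposition ι k s Λ A B) (i : Fin s),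
      ENNReal.ofReal (overlap h (A i) (B i))

/-- Increasing sequences of positive integers with `∑ 1/s_k < ∞` and `∑ s_k/l_k < ∞`. -/
structure IsAdmissible (D : ℕ) (s : ℕ → ℕ) : Prop where
  pos : ∀ k, 0 < s k
  increasing : Monotone s
  summable_inv : Summable fun k => 1 / (s k : ℝ)
  summable_div : Summable fun k => (s k : ℝ) / len D k

/-- Summability of the `δ_k`, `k ≥ 1`, over the `s_k`-decompositions. -/
def ConditionC (ι : Γ → PiLp p (fun _ : Fin D => ℝ)) (h : Interaction Γ d) (s : ℕ → ℕ) : Prop :=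
  ∑' k : ℕ, deltaSup ι h (k + 1) (s (k + 1)) < ∞

/-- The infimum `λ_k` of the spectral gaps over all regions in `F_k`. -/
def gapInf (ι : Γ → PiLp p (fun _ : Fin D => ℝ)) (h : Interaction Γ d) (k : ℕ) : ℝ≥0∞ :=
  ⨅ Λ ∈ regionClass ι k, gap h Λ

end Geometry

end SpinLattice

end

open SpinLattice

/-! Frustration freeness puts `P_Λ` onto the common kernel of the terms. Hence `c` is a lower bound
of the gap exactly when `c ‖(1 - P_Λ) v‖² ≤ ∑ ‖h(X) v‖²` for all `v` (`IsAnnihilating.le_gap_iff`),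
and such a bound survives embedding into a larger region.

Gap implies decay. Let `L` be the product of all `1 - h(X)` in `Λ = A ∪ B`, in any order. By the
detectability lemma, `L ψ` can keep its norm only if its energy is small, because each term fails to
commute with boundedly many others; the gap then gives `‖L - P_Λ‖ ≤ q < 1` (`norm_prod_sub_le`), and
a product of `n` such `L` is within `q ^ n` of `P_Λ`. If `n r < l`, the orders can be chosen so that
this product splits into a left part absorbed by `P_A` and a right part absorbed by `P_B`. So `P_A
P_B - P_Λ` has norm at most `q ^ n`, which is exponential in the overlap
(`IsFrustrationFree.overlap_le_pow`).

Decay implies gap. If `A` and `B` have gap at least `c`, quasi-factorization gives `c (1 - δ(A,B))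
(1 - P_Λ) ≤ H_A + H_B ≤ H_Λ + H_{A ∩ B}`. Averaging over `s` decompositions with disjoint overlaps
bounds the last term by `H_Λ / s`, so one scale costs the factor `(1 - δ_k) / (1 + 1/s_k)`. The
product of these factors stays positive when `∑ δ_k` and `∑ 1/s_k` converge. The decompositions come
from parallel cuts across the longest side.

Polynomial decay makes `∑ δ_k` finite for `s_k = (k+1)²`, since `l_k` grows geometrically;
exponential decay does so for every admissible sequence, since it implies decay like `1/l` and `∑
s_k / l_k < ∞`. -/

noncomputable section

namespace SpinLattice

/-! ### Embedding local observables; locality as commutation -/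

section ExtendAlgebra

open scoped Classical

variable {Γ : Type*} {d : ℕ}

/-- Splitting a configuration of `Λ` into its part in `X` and the rest. -/
def configSplit {X Λ : Finset Γ} (hX : X ⊆ Λ) :
    Config d Λ ≃ Config d X × ({x : {x // x ∈ Λ} // (x : Γ) ∉ X} → Fin d) where
  toFun σ := (Finset.restrict₂ (π := fun _ => Fin d) hX σ, fun y => σ y.1)
  invFun ρ := fun x => if hx : (x : Γ) ∈ X then ρ.1 ⟨x, hx⟩ else ρ.2 ⟨x, hx⟩
  left_inv σ := by
    ext x
    by_cases hx : (x : Γ) ∈ X <;> simp [hx]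
  right_inv ρ := by
    refine Prod.ext ?_ ?_
    · funext x; simp
    · funext y; simp [y.2]

theorem extend_eq_submatrix {X Λ : Finset Γ} (hX : X ⊆ Λ) (M : Observable d X) :
    extend hX M = (Matrix.kronecker M
      (1 : Matrix ({x : {x // x ∈ Λ} // (x : Γ) ∉ X} → Fin d) _ ℂ)).submatrix
        (configSplit hX) (configSplit hX) := by
  ext σ τ
  simp only [extend, Matrix.of_apply, Matrix.submatrix_apply, Matrix.kronecker,
    Matrix.kroneckerMap_apply, Matrix.one_apply]
  by_cases hc : ∀ x : {x // x ∈ Λ}, (x : Γ) ∉ X → σ x = τ x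
  · have h2 : (configSplit hX σ).2 = (configSplit hX τ).2 := by
      funext y; exact hc y.1 y.2
    rw [if_pos hc, if_pos h2]
    simp [configSplit]
  · have h2 : (configSplit hX σ).2 ≠ (configSplit hX τ).2 := fun h =>
      hc fun x hx => congrFun h ⟨x, hx⟩
    rw [if_neg hc, if_neg h2]
    simp

/-- `extend` as a homomorphism of star algebras. -/
def extendHom {X Λ : Finset Γ} (hX : X ⊆ Λ) : Observable d X →⋆ₐ[ℂ] Observable d Λ where
  toFun := extend hX
  map_one' := by
    rw [extend_eq_submatrix, Matrix.kronecker, Matrix.one_kronecker_one]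
    exact Matrix.submatrix_one_equiv _
  map_mul' M N := by
    simp only [extend_eq_submatrix]
    rw [Matrix.submatrix_mul_equiv]
    congr 1
    simp only [Matrix.kronecker]
    rw [← Matrix.mul_kronecker_mul, Matrix.mul_one]
  map_zero' := by
    ext σ τ; simp [extend]
  map_add' M N := by
    ext σ τ
    simp only [extend, Matrix.of_apply, Matrix.add_apply]
    split_ifs <;> simp
  commutes' c := by
    ext σ τ
    simp only [extend, Matrix.of_apply, Matrix.algebraMap_matrix_apply]
    by_cases hc : ∀ x : {x // x ∈ Λ}, (x : Γ) ∉ X → σ x = τ x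
    · rw [if_pos hc]
      have : Finset.restrict₂ (π := fun _ => Fin d) hX σ
          = Finset.restrict₂ (π := fun _ => Fin d) hX τ ↔ σ = τ := by
        constructor
        · intro h
          funext x
          by_cases hx : (x : Γ) ∈ X
          · exact congrFun h ⟨x, hx⟩
          · exact hc x hx
        · rintro rfl; rfl
      simp [this]
    · rw [if_neg hc, if_neg]
      rintro rfl
      exact hc fun _ _ => rfl
  map_star' M := by
    ext σ τ
    simp only [extend, Matrix.of_apply, Matrix.star_apply]
    have : (∀ x : {x // x ∈ Λ}, (x : Γ) ∉ X → σ x = τ x) ↔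
        (∀ x : {x // x ∈ Λ}, (x : Γ) ∉ X → τ x = σ x) :=
      forall₂_congr fun _ _ => eq_comm
    by_cases hc : ∀ x : {x // x ∈ Λ}, (x : Γ) ∉ X → σ x = τ x
    · rw [if_pos hc, if_pos (this.mp hc)]
    · rw [if_neg hc, if_neg (fun h => hc (this.mpr h))]; simp

theorem extend_extend {X Y Λ : Finset Γ} (hX : X ⊆ Y) (hY : Y ⊆ Λ) (M : Observable d X) :
    extend hY (extend hX M) = extend (hX.trans hY) M := by
  ext σ τ
  simp only [extend, Matrix.of_apply]
  by_cases hc : ∀ x : {x // x ∈ Λ}, (x : Γ) ∉ X → σ x = τ x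
  · rw [if_pos hc, if_pos (fun x hx => hc x fun h => hx (hX h))]
    exact if_pos fun (x : {x // x ∈ Y}) hx => hc ⟨x, hY x.2⟩ hx
  · rw [if_neg hc]
    by_cases h1 : ∀ x : {x // x ∈ Λ}, (x : Γ) ∉ Y → σ x = τ x
    · rw [if_pos h1, if_neg]
      intro h2
      refine hc fun x hx => ?_
      by_cases hxY : (x : Γ) ∈ Y
      · exact h2 ⟨x, hxY⟩ hx
      · exact h1 x hxY
    · rw [if_neg h1]

theorem extend_self {X : Finset Γ} (M : Observable d X) : extend (subset_refl X) M = M := by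
  ext σ τ
  simp only [extend, Matrix.of_apply]
  rw [if_pos fun x hx => absurd x.2 hx]
  rfl

/-- For disjoint supports a single intermediate configuration survives in the matrix product, and
the resulting entry is symmetric in the two factors. -/
theorem extend_mul_extend_apply {X Y Λ : Finset Γ} (hX : X ⊆ Λ) (hY : Y ⊆ Λ)
    (hXY : Disjoint X Y) (M : Observable d X) (N : Observable d Y) (σ τ : Config d Λ) :
    (extend hX M * extend hY N) σ τ =
      if ∀ x : {x // x ∈ Λ}, (x : Γ) ∉ X → (x : Γ) ∉ Y → σ x = τ x then
        M (Finset.restrict₂ (π := fun _ => Fin d) hX σ)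
            (Finset.restrict₂ (π := fun _ => Fin d) hX τ) *
          N (Finset.restrict₂ (π := fun _ => Fin d) hY σ)
            (Finset.restrict₂ (π := fun _ => Fin d) hY τ)
      else 0 := by
  have hd : ∀ {x : Γ}, x ∈ X → x ∉ Y := fun hx hy => Finset.disjoint_left.mp hXY hx hy
  rw [Matrix.mul_apply]
  -- `M` acts only inside `X` and `N` leaves `X` alone, which forces the values `τ` on `X` and `σ`
  -- off `X`.
  let ρ₀ : Config d Λ := fun x => if (x : Γ) ∈ X then τ x else σ x
  rw [Finset.sum_eq_single ρ₀]
  · have h1 : ∀ x : {x // x ∈ Λ}, (x : Γ) ∉ X → σ x = ρ₀ x := fun x hx => by simp [ρ₀, hx]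
    have h2 : Finset.restrict₂ (π := fun _ => Fin d) hX ρ₀
        = Finset.restrict₂ (π := fun _ => Fin d) hX τ := by
      funext x; simp [ρ₀]
    have h3 : Finset.restrict₂ (π := fun _ => Fin d) hY ρ₀
        = Finset.restrict₂ (π := fun _ => Fin d) hY σ := by
      funext x
      have : (x : Γ) ∉ X := fun h => hd h x.2
      simp [ρ₀, this]
    simp only [extend, Matrix.of_apply]
    rw [if_pos h1, h2, h3]
    by_cases hc : ∀ x : {x // x ∈ Λ}, (x : Γ) ∉ X → (x : Γ) ∉ Y → σ x = τ x
    · rw [if_pos hc, if_pos]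
      intro x hx
      by_cases hxX : (x : Γ) ∈ X
      · simp [ρ₀, hxX]
      · simpa [ρ₀, hxX] using hc x hxX hx
    · rw [if_neg hc, if_neg, mul_zero]
      intro h
      refine hc fun x hx hy => ?_
      simpa [ρ₀, hx] using h x hy
  · intro ρ _ hρ
    simp only [extend, Matrix.of_apply]
    by_cases h1 : ∀ x : {x // x ∈ Λ}, (x : Γ) ∉ X → σ x = ρ x
    · by_cases h2 : ∀ x : {x // x ∈ Λ}, (x : Γ) ∉ Y → ρ x = τ x
      · refine absurd (funext fun x => ?_) hρ
        by_cases hx : (x : Γ) ∈ X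
        · simpa [ρ₀, hx] using h2 x (hd hx)
        · simpa [ρ₀, hx] using (h1 x hx).symm
      · rw [if_neg h2, mul_zero]
    · rw [if_neg h1, zero_mul]
  · intro h; exact absurd (Finset.mem_univ _) h

theorem extend_commute {X Y Λ : Finset Γ} (hX : X ⊆ Λ) (hY : Y ⊆ Λ)
    (hXY : Disjoint X Y) (M : Observable d X) (N : Observable d Y) :
    Commute (extend hX M) (extend hY N) := by
  ext σ τ
  rw [extend_mul_extend_apply hX hY hXY, extend_mul_extend_apply hY hX hXY.symm]
  have : (∀ x : {x // x ∈ Λ}, (x : Γ) ∉ X → (x : Γ) ∉ Y → σ x = τ x) ↔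
      (∀ x : {x // x ∈ Λ}, (x : Γ) ∉ Y → (x : Γ) ∉ X → σ x = τ x) :=
    forall_congr' fun _ => Imp.swap
  by_cases hc : ∀ x : {x // x ∈ Λ}, (x : Γ) ∉ X → (x : Γ) ∉ Y → σ x = τ x
  · rw [if_pos hc, if_pos (this.mp hc), mul_comm]
  · rw [if_neg hc, if_neg (fun h => hc (this.mpr h))]

/-- The operator on `ℋ_Λ` defined by an observable of a subregion. -/
def embed {X Λ : Finset Γ} (hX : X ⊆ Λ) :
    Observable d X →⋆ₐ[ℂ] (HilbertSpace d Λ →L[ℂ] HilbertSpace d Λ) :=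
  ((Matrix.toEuclideanCLM (n := Config d Λ) (𝕜 := ℂ)) :
    Observable d Λ →⋆ₐ[ℂ] (HilbertSpace d Λ →L[ℂ] HilbertSpace d Λ)).comp (extendHom hX)

theorem embed_apply {X Λ : Finset Γ} (hX : X ⊆ Λ) (M : Observable d X) :
    embed hX M = toOp (extend hX M) := rfl

theorem embed_self {X : Finset Γ} (M : Observable d X) : embed (subset_refl X) M = toOp M := by
  rw [embed_apply, extend_self]

theorem embed_extend {X Y Λ : Finset Γ} (hX : X ⊆ Y) (hY : Y ⊆ Λ) (M : Observable d X) :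
    embed hY (extend hX M) = embed (hX.trans hY) M := by
  rw [embed_apply, embed_apply, extend_extend]

theorem embed_commute {X Y Λ : Finset Γ} (hX : X ⊆ Λ) (hY : Y ⊆ Λ)
    (hXY : Disjoint X Y) (M : Observable d X) (N : Observable d Y) :
    Commute (embed hX M) (embed hY N) := by
  rw [embed_apply, embed_apply]
  exact (extend_commute hX hY hXY M N).map (Matrix.toEuclideanCLM (n := Config d Λ) (𝕜 := ℂ))

end ExtendAlgebra

/-! ### Projections on a Hilbert space: quasi-factorization and detectability -/

section Operators

/-- Each `u j` only has to pass the earlier `v i`. This separates the layers of the approximate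
ground state projector into two blocks. -/
theorem prod_mul_prod_of_commute {M : Type*} [Monoid M] (u v : ℕ → M) (n : ℕ)
    (h : ∀ i j, i < j → j < n → Commute (v i) (u j)) :
    ((List.range n).map fun i => u i * v i).prod =
      ((List.range n).map u).prod * ((List.range n).map v).prod := by
  induction n with
  | zero => simp
  | succ n ih =>
    rw [List.prod_range_succ, List.prod_range_succ, List.prod_range_succ,
      ih fun i j hij hj => h i j hij (hj.trans n.lt_succ_self)]
    have hc : Commute ((List.range n).map v).prod (u n) := by
      refine Commute.list_prod_left _ _ fun x hx => ?_
      obtain ⟨i, hi, rfl⟩ := List.mem_map.mp hx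
      exact h i n (List.mem_range.mp hi) n.lt_succ_self
    rw [mul_assoc, ← mul_assoc _ (u n), hc.eq, mul_assoc, mul_assoc]

theorem prod_one_sub_mul {α R : Type*} [Ring R] (Q : α → R) (P : R) (l : List α)
    (h : ∀ i ∈ l, Q i * P = 0) : (l.map fun i => 1 - Q i).prod * P = P := by
  induction l with
  | nil => simp
  | cons j l ih =>
    rw [List.map_cons, List.prod_cons, mul_assoc, ih fun i hi => h i (List.mem_cons_of_mem _ hi),
      sub_mul, one_mul, h j List.mem_cons_self, sub_zero]

theorem mul_prod_one_sub {α R : Type*} [Ring R] (Q : α → R) (P : R) (l : List α)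
    (h : ∀ i ∈ l, P * Q i = 0) : P * (l.map fun i => 1 - Q i).prod = P := by
  induction l with
  | nil => simp
  | cons j l ih =>
    rw [List.map_cons, List.prod_cons, ← mul_assoc, mul_sub, mul_one, h j List.mem_cons_self,
      sub_zero, ih fun i hi => h i (List.mem_cons_of_mem _ hi)]

open scoped InnerProductSpace

variable {E : Type*} [NormedAddCommGroup E] [InnerProductSpace ℂ E] [CompleteSpace E]

theorem inner_projection_left {Q : E →L[ℂ] E} (hQ : IsStarProjection Q) (v w : E) :
    ⟪Q v, w⟫_ℂ = ⟪v, Q w⟫_ℂ :=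
  hQ.isSelfAdjoint.isSymmetric v w

theorem projection_apply_apply {Q : E →L[ℂ] E} (hQ : IsStarProjection Q) (v : E) :
    Q (Q v) = Q v :=
  congrArg (fun T : E →L[ℂ] E => T v) hQ.isIdempotentElem

theorem re_inner_projection {Q : E →L[ℂ] E} (hQ : IsStarProjection Q) (v : E) :
    (⟪v, Q v⟫_ℂ).re = ‖Q v‖ ^ 2 := by
  rw [← projection_apply_apply hQ v, ← inner_projection_left hQ, projection_apply_apply hQ]
  exact inner_self_eq_norm_sq (𝕜 := ℂ) _

theorem norm_one_sub_projection_sq {Q : E →L[ℂ] E} (hQ : IsStarProjection Q) (v : E) :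
    ‖(1 - Q) v‖ ^ 2 = ‖v‖ ^ 2 - ‖Q v‖ ^ 2 := by
  rw [← re_inner_projection hQ.one_sub, ← re_inner_projection hQ]
  simp only [sub_apply, one_apply_eq_self, inner_sub_right,
    Complex.sub_re]
  congr 1
  exact inner_self_eq_norm_sq (𝕜 := ℂ) _

theorem norm_projection_apply_le {Q : E →L[ℂ] E} (hQ : IsStarProjection Q) (v : E) :
    ‖Q v‖ ≤ ‖v‖ := by
  have h := norm_one_sub_projection_sq hQ v
  have := sq_nonneg ‖(1 - Q) v‖
  exact (sq_le_sq₀ (norm_nonneg _) (norm_nonneg _)).mp (by linarith)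

theorem norm_projection_le_one {Q : E →L[ℂ] E} (hQ : IsStarProjection Q) : ‖Q‖ ≤ 1 :=
  ContinuousLinearMap.opNorm_le_bound _ zero_le_one fun v => by
    simpa using norm_projection_apply_le hQ v

/-- Two orthogonal projections satisfy `P + Q ≤ 1 + ‖P Q‖`. -/
theorem norm_sq_add_norm_sq_le {P Q : E →L[ℂ] E} (hP : IsStarProjection P)
    (hQ : IsStarProjection Q) (v : E) :
    ‖P v‖ ^ 2 + ‖Q v‖ ^ 2 ≤ (1 + ‖P * Q‖) * ‖v‖ ^ 2 := by
  -- Here `t = ⟪v, (P + Q) v⟫`, so Cauchy-Schwarz gives `t² ≤ ‖v‖² ‖(P + Q) v‖²`; expanding the last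
  -- square bounds it by `(1 + ‖P Q‖) t`, and one factor `t` cancels.
  set t := ‖P v‖ ^ 2 + ‖Q v‖ ^ 2 with ht
  have ht0 : 0 ≤ t := by positivity
  have h1 : t ≤ ‖v‖ * ‖P v + Q v‖ := by
    have : t = (⟪v, P v + Q v⟫_ℂ).re := by
      rw [inner_add_right, Complex.add_re, re_inner_projection hP, re_inner_projection hQ]
    rw [this]
    exact re_inner_le_norm (𝕜 := ℂ) _ _
  have h2 : (⟪P v, Q v⟫_ℂ).re ≤ ‖P * Q‖ * (‖P v‖ * ‖Q v‖) := by
    have e : ⟪P v, Q v⟫_ℂ = ⟪P v, (P * Q) (Q v)⟫_ℂ := by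
      rw [mul_apply_eq_comp, projection_apply_apply hQ, ← inner_projection_left hP,
        projection_apply_apply hP]
    rw [e]
    refine (re_inner_le_norm (𝕜 := ℂ) _ _).trans ?_
    have := (P * Q).le_opNorm (Q v)
    nlinarith [norm_nonneg (P v)]
  have h3 : ‖P v + Q v‖ ^ 2 ≤ (1 + ‖P * Q‖) * t := by
    rw [norm_add_sq (𝕜 := ℂ)]
    have h4 : 2 * (‖P v‖ * ‖Q v‖) ≤ t := by nlinarith [sq_nonneg (‖P v‖ - ‖Q v‖)]
    have h5 := mul_le_mul_of_nonneg_left h4 (norm_nonneg (P * Q))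
    have h6 : RCLike.re ⟪P v, Q v⟫_ℂ = (⟪P v, Q v⟫_ℂ).re := rfl
    rw [h6]
    nlinarith
  have h7 : t * t ≤ t * ((1 + ‖P * Q‖) * ‖v‖ ^ 2) := by
    calc t * t = t ^ 2 := (sq t).symm
      _ ≤ (‖v‖ * ‖P v + Q v‖) ^ 2 := pow_le_pow_left₀ ht0 h1 2
      _ = ‖v‖ ^ 2 * ‖P v + Q v‖ ^ 2 := mul_pow _ _ _
      _ ≤ ‖v‖ ^ 2 * ((1 + ‖P * Q‖) * t) := by gcongr
      _ = _ := by ring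
  rcases ht0.eq_or_lt with h0 | h0
  · rw [← h0]; positivity
  · exact le_of_mul_le_mul_left h7 h0

/-- Quasi-factorization of excitations. -/
theorem quasi_factorization {P Q R : E →L[ℂ] E} (hP : IsStarProjection P)
    (hQ : IsStarProjection Q) (hR : IsStarProjection R) (hPR : P * R = R) (hQR : Q * R = R)
    (v : E) :
    (1 - ‖(P - R) * (Q - R)‖) * ‖(1 - R) v‖ ^ 2 ≤ ‖(1 - P) v‖ ^ 2 + ‖(1 - Q) v‖ ^ 2 := by
  have hRP : R * P = R := by
    have := congrArg star hPR
    rwa [star_mul, hP.isSelfAdjoint.star_eq, hR.isSelfAdjoint.star_eq] at this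
  have hRQ : R * Q = R := by
    have := congrArg star hQR
    rwa [star_mul, hQ.isSelfAdjoint.star_eq, hR.isSelfAdjoint.star_eq] at this
  have hP' : IsStarProjection (P - R) := by
    refine ⟨?_, hP.isSelfAdjoint.sub hR.isSelfAdjoint⟩
    have h1 : P * P = P := hP.isIdempotentElem
    have h2 : R * R = R := hR.isIdempotentElem
    change (P - R) * (P - R) = P - R
    rw [sub_mul, mul_sub, mul_sub, h1, h2, hPR, hRP]; abel
  have hQ' : IsStarProjection (Q - R) := by
    refine ⟨?_, hQ.isSelfAdjoint.sub hR.isSelfAdjoint⟩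
    have h1 : Q * Q = Q := hQ.isIdempotentElem
    have h2 : R * R = R := hR.isIdempotentElem
    change (Q - R) * (Q - R) = Q - R
    rw [sub_mul, mul_sub, mul_sub, h1, h2, hQR, hRQ]; abel
  -- On `(1 - R) v` the projections `P - R` and `Q - R` act like `P` and `Q`, so Pythagoras turns
  -- this upper bound into the desired lower bound for `1 - P` and `1 - Q`.
  have key := norm_sq_add_norm_sq_le hP' hQ' ((1 - R) v)
  have e : ∀ {S : E →L[ℂ] E}, IsStarProjection S → S * R = R →
      ‖(1 - S) v‖ ^ 2 = ‖(1 - R) v‖ ^ 2 - ‖(S - R) ((1 - R) v)‖ ^ 2 := by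
    intro S hS hSR
    have h2 : R * R = R := hR.isIdempotentElem
    have e1 : (1 - S) v = (1 - S) ((1 - R) v) := by
      rw [← mul_apply_eq_comp]
      congr 1
      rw [mul_sub, sub_mul, sub_mul, hSR]; simp
    have e2 : (S - R) ((1 - R) v) = S ((1 - R) v) := by
      rw [← mul_apply_eq_comp, ← mul_apply_eq_comp]
      congr 1
      rw [mul_sub, sub_mul, mul_sub, sub_mul, hSR, h2]; simp
    rw [e1, e2, norm_one_sub_projection_sq hS]
  rw [e hP hPR, e hQ hQR]
  linarith

open scoped Classical in
/-- The detectability lemma: the energy of the terms `Q i` in the state `∏ (1 - Q i) ψ`. -/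
theorem detectability {α : Type*} [DecidableEq α] (Q : α → E →L[ℂ] E) (g : ℕ) (l : List α) (hl : l.Nodup)
    (hQ : ∀ i ∈ l, IsStarProjection (Q i))
    (hg : ∀ i ∈ l, (l.toFinset.filter fun j => ¬ Commute (Q i) (Q j)).card ≤ g) (ψ : E) :
    ∑ i ∈ l.toFinset, ‖Q i ((l.map fun i => 1 - Q i).prod ψ)‖ ^ 2 ≤
      (g : ℝ) ^ 2 * (‖ψ‖ ^ 2 - ‖(l.map fun i => 1 - Q i).prod ψ‖ ^ 2) := by
  -- `e j` is the norm of the component removed when the factor `1 - Q j` acts, so the squares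
  -- telescope to the total loss of norm. Moving `Q i` through the product costs nothing at a
  -- commuting factor and at most `e j` at another one, until it is annihilated by its own factor.
  have main : ∀ l : List α, l.Nodup → (∀ i ∈ l, IsStarProjection (Q i)) →
      ∃ e : α → ℝ, (∀ j, 0 ≤ e j) ∧ ∑ j ∈ l.toFinset, e j ^ 2
          = ‖ψ‖ ^ 2 - ‖(l.map fun i => 1 - Q i).prod ψ‖ ^ 2 ∧
        ∀ i ∈ l, ‖Q i ((l.map fun i => 1 - Q i).prod ψ)‖ ≤
          ∑ j ∈ l.toFinset.filter (fun j => ¬ Commute (Q i) (Q j)), e j := by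
    intro l
    induction l with
    | nil => intro _ _; exact ⟨0, by simp, by simp, by simp⟩
    | cons j l ih =>
      intro hnd hpr
      obtain ⟨e, he0, he1, he2⟩ := ih (List.nodup_cons.mp hnd).2
        fun i hi => hpr i (List.mem_cons_of_mem _ hi)
      have hj : j ∉ l.toFinset := by simpa using (List.nodup_cons.mp hnd).1
      have hQj := hpr j List.mem_cons_self
      set φ := (l.map fun i => 1 - Q i).prod ψ with hφ
      have hφ' : ((j :: l).map fun i => 1 - Q i).prod ψ = (1 - Q j) φ := by
        rw [List.map_cons, List.prod_cons, mul_apply_eq_comp]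
      have hup : ∀ i ∈ l.toFinset, Function.update e j ‖Q j φ‖ i = e i := fun i hi =>
        Function.update_of_ne (ne_of_mem_of_not_mem hi hj) _ _
      refine ⟨Function.update e j ‖Q j φ‖, fun k => ?_, ?_, ?_⟩
      · rcases eq_or_ne k j with rfl | hk
        · rw [Function.update_self]; exact norm_nonneg _
        · rw [Function.update_of_ne hk]; exact he0 k
      · rw [hφ', List.toFinset_cons, Finset.sum_insert hj, Function.update_self,
          Finset.sum_congr rfl (fun i hi => by rw [hup i hi]), he1,
          norm_one_sub_projection_sq hQj]
        ring
      · intro i hi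
        rw [hφ', List.toFinset_cons, Finset.filter_insert]
        have hsum : ∑ k ∈ l.toFinset.filter (fun k => ¬ Commute (Q i) (Q k)),
            Function.update e j ‖Q j φ‖ k
            = ∑ k ∈ l.toFinset.filter (fun k => ¬ Commute (Q i) (Q k)), e k :=
          Finset.sum_congr rfl fun k hk => hup k (Finset.mem_filter.mp hk).1
        rcases List.mem_cons.mp hi with rfl | hil
        · have h0 : Q i ((1 - Q i) φ) = 0 := by
            rw [← mul_apply_eq_comp, hQj.mul_one_sub_self]; rfl
          rw [h0, norm_zero, if_neg (not_not.mpr (Commute.refl _))]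
          rw [hsum]
          exact Finset.sum_nonneg fun k _ => he0 k
        · by_cases hc : Commute (Q i) (Q j)
          · rw [if_neg (not_not.mpr hc), hsum]
            have : Q i ((1 - Q j) φ) = (1 - Q j) (Q i φ) := by
              change (Q i * (1 - Q j)) φ = ((1 - Q j) * Q i) φ
              rw [((Commute.one_right _).sub_right hc).eq]
            rw [this]
            exact (norm_projection_apply_le hQj.one_sub _).trans (he2 i hil)
          · rw [if_pos hc, Finset.sum_insert (fun h => hj (Finset.mem_filter.mp h).1), hsum,
              Function.update_self]
            have hQi := hpr i hi
            have h1 : Q i ((1 - Q j) φ) = Q i φ - Q i (Q j φ) := by simp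
            rw [h1]
            have h2 := norm_sub_le (Q i φ) (Q i (Q j φ))
            have h3 := norm_projection_apply_le hQi (Q j φ)
            have h4 := he2 i hil
            linarith
  obtain ⟨e, -, he1, he2⟩ := main l hl hQ
  rw [← he1]
  have hsymm : ∀ i j, ¬ Commute (Q i) (Q j) ↔ ¬ Commute (Q j) (Q i) := fun i j =>
    not_congr (Commute.symm_iff)
  calc ∑ i ∈ l.toFinset, ‖Q i ((l.map fun i => 1 - Q i).prod ψ)‖ ^ 2
      ≤ ∑ i ∈ l.toFinset, (g : ℝ) *
          ∑ j ∈ l.toFinset.filter (fun j => ¬ Commute (Q i) (Q j)), e j ^ 2 := by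
        refine Finset.sum_le_sum fun i hi => ?_
        have hil := List.mem_toFinset.mp hi
        refine (pow_le_pow_left₀ (norm_nonneg _) (he2 i hil) 2).trans ?_
        -- Cauchy-Schwarz over at most `g` indices: the first factor `g`. The second comes from
        -- exchanging the sums, as each `e j ^ 2` is then counted at most `g` times.
        refine sq_sum_le_card_mul_sum_sq.trans ?_
        refine mul_le_mul_of_nonneg_right ?_ (Finset.sum_nonneg fun _ _ => sq_nonneg _)
        exact_mod_cast hg i hil
    _ = (g : ℝ) * ∑ j ∈ l.toFinset,
          ((l.toFinset.filter (fun i => ¬ Commute (Q j) (Q i))).card : ℝ) * e j ^ 2 := by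
        rw [← Finset.mul_sum]
        congr 1
        simp_rw [Finset.sum_filter]
        rw [Finset.sum_comm]
        refine Finset.sum_congr rfl fun j _ => ?_
        rw [← Finset.sum_filter, Finset.sum_const, nsmul_eq_mul]
        congr 3
        ext i
        simp [hsymm i j]
    _ ≤ (g : ℝ) * ∑ j ∈ l.toFinset, (g : ℝ) * e j ^ 2 := by
        refine mul_le_mul_of_nonneg_left (Finset.sum_le_sum fun j hj => ?_) (Nat.cast_nonneg _)
        refine mul_le_mul_of_nonneg_right ?_ (sq_nonneg _)
        exact_mod_cast hg j (List.mem_toFinset.mp hj)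
    _ = _ := by rw [← Finset.mul_sum]; ring

theorem mul_eq_zero_symm {P Q : E →L[ℂ] E} (hP : IsStarProjection P) (hQ : IsStarProjection Q)
    (h : Q * P = 0) : P * Q = 0 := by
  have := congrArg star h
  rwa [star_mul, hP.isSelfAdjoint.star_eq, hQ.isSelfAdjoint.star_eq, star_zero] at this

-- Detectability bounds the energy of `L ψ` above by its loss of norm, the gap bounds it below by `c
-- ‖L ψ‖²`; together they force contraction on the complement of `P`.
open scoped Classical in
theorem norm_prod_sub_le {α : Type*} [DecidableEq α] (Q : α → E →L[ℂ] E) (g : ℕ) (hg0 : 0 < g) (l : List α)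
    (hl : l.Nodup) (hQ : ∀ i ∈ l, IsStarProjection (Q i))
    (hg : ∀ i ∈ l, (l.toFinset.filter fun j => ¬ Commute (Q i) (Q j)).card ≤ g)
    {P : E →L[ℂ] E} (hP : IsStarProjection P) (hQP : ∀ i ∈ l, Q i * P = 0) {c : ℝ} (hc : 0 < c)
    (hgap : ∀ v : E, c * ‖(1 - P) v‖ ^ 2 ≤ ∑ i ∈ l.toFinset, ‖Q i v‖ ^ 2) :
    ‖(l.map fun i => 1 - Q i).prod - P‖ ≤ 1 / Real.sqrt (1 + c / (g : ℝ) ^ 2) := by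
  have hg1 : (0 : ℝ) < (g : ℝ) ^ 2 := by positivity
  have hpos : 0 < 1 + c / (g : ℝ) ^ 2 := by positivity
  refine ContinuousLinearMap.opNorm_le_bound _ (by positivity) fun v => ?_
  set L := (l.map fun i => 1 - Q i).prod with hL
  have hLP : L * P = P := prod_one_sub_mul Q P l hQP
  have hPL : P * L = P :=
    mul_prod_one_sub Q P l fun i hi => mul_eq_zero_symm hP (hQ i hi) (hQP i hi)
  have e1 : (L - P) v = L ((1 - P) v) := by
    change (L - P) v = (L * (1 - P)) v
    rw [mul_sub, mul_one, hLP]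
  -- `L` preserves the complement of the range of `P`, so the gap applies to the full vector `L ((1
  -- - P) v)`.
  have e2 : (1 - P) (L ((1 - P) v)) = L ((1 - P) v) := by
    change ((1 - P) * (L * (1 - P))) v = (L * (1 - P)) v
    rw [← mul_assoc, sub_mul 1 P L, one_mul, hPL, sub_mul, hP.mul_one_sub_self, sub_zero]
  have h1 := detectability Q g l hl hQ hg ((1 - P) v)
  have h2 := hgap (L ((1 - P) v))
  rw [e2] at h2
  have h3 := norm_projection_apply_le hP.one_sub v
  rw [e1]
  set a := ‖L ((1 - P) v)‖ with ha
  have ha0 : 0 ≤ a := norm_nonneg _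
  have h4 : c * a ^ 2 ≤ (g : ℝ) ^ 2 * (‖v‖ ^ 2 - a ^ 2) := by
    refine (h2.trans h1).trans ?_
    have := pow_le_pow_left₀ (norm_nonneg _) h3 2
    gcongr
  have h5 : (1 + c / (g : ℝ) ^ 2) * a ^ 2 ≤ ‖v‖ ^ 2 := by
    have : c / (g : ℝ) ^ 2 * a ^ 2 = (c * a ^ 2) / (g : ℝ) ^ 2 := by ring
    rw [add_mul, one_mul, this]
    have := (div_le_iff₀ hg1).mpr (h4.trans_eq (mul_comm _ _))
    linarith
  rw [div_mul_eq_mul_div, one_mul, le_div_iff₀ (Real.sqrt_pos.mpr hpos)]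
  refine (sq_le_sq₀ (by positivity) (norm_nonneg _)).mp ?_
  rw [mul_pow, Real.sq_sqrt hpos.le]
  linarith

/-- Since every factor fixes `P` from both sides, the error of a product is the product of the
errors. -/
theorem norm_prod_range_sub_le (L : ℕ → E →L[ℂ] E) {P : E →L[ℂ] E} (hP : IsStarProjection P)
    (hLP : ∀ i, L i * P = P) (hPL : ∀ i, P * L i = P) {q : ℝ} (hq : ∀ i, ‖L i - P‖ ≤ q) (n : ℕ) :
    ‖((List.range (n + 1)).map L).prod - P‖ ≤ q ^ (n + 1) := by
  have hPP : P * P = P := hP.isIdempotentElem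
  have hq0 : 0 ≤ q := (norm_nonneg _).trans (hq 0)
  induction n with
  | zero => simpa using hq 0
  | succ n ih =>
    have hLn : ((List.range (n + 1)).map L).prod * P = P := by
      generalize n + 1 = m
      induction m with
      | zero => simp
      | succ m ihm => rw [List.prod_range_succ, mul_assoc, hLP, ihm]
    have e : ((List.range (n + 1 + 1)).map L).prod - P
        = (((List.range (n + 1)).map L).prod - P) * (L (n + 1) - P) := by
      rw [List.prod_range_succ, sub_mul, mul_sub, mul_sub, hLn, hPL, hPP]; abel
    rw [e, pow_succ]
    exact (norm_mul_le _ _).trans (mul_le_mul ih (hq _) (norm_nonneg _) (by positivity))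

end Operators

/-! ### Spectral bounds for symmetric operators in finite dimension -/

section Spectral

open scoped InnerProductSpace
open Module.End

variable {E : Type*} [NormedAddCommGroup E] [InnerProductSpace ℂ E] [FiniteDimensional ℂ E]

theorem starProjection_eigenspace_of_hasEigenvector_ne {T : E →ₗ[ℂ] E} (hT : T.IsSymmetric)
    {μ ν : ℂ} (hμν : μ ≠ ν) {w : E} (hw : T w = ν • w) :
    (eigenspace T μ).starProjection w = 0 := by
  rw [Submodule.starProjection_apply_eq_zero_iff]
  intro u hu
  exact hT.orthogonalFamily_eigenspaces hμν ⟨u, hu⟩ ⟨w, mem_eigenspace_iff.mpr hw⟩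

/-- A lower bound on the non-zero eigenvalues is a lower bound of the operator on the orthogonal
complement of its kernel. -/
theorem mul_norm_sq_le_re_inner [CompleteSpace E] {T : E →ₗ[ℂ] E} (hT : T.IsSymmetric) {c : ℝ}
    (hc : ∀ μ : ℝ, HasEigenvalue T (μ : ℂ) → μ ≠ 0 → c ≤ μ) (v : E) :
    c * ‖(1 - (eigenspace T 0).starProjection) v‖ ^ 2 ≤ (⟪v, T v⟫_ℂ).re := by
  set P := (eigenspace T 0).starProjection with hP
  have hPp : IsStarProjection P := isStarProjection_starProjection
  -- In an eigenbasis the inequality holds coefficient by coefficient: `1 - P` kills the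
  -- eigenvectors with eigenvalue zero and fixes the others.
  let b := hT.eigenvectorBasis rfl
  let μ := hT.eigenvalues rfl
  have hb : ∀ i, T (b i) = (μ i : ℂ) • b i := hT.apply_eigenvectorBasis rfl
  have e1 : (⟪v, T v⟫_ℂ).re = ∑ i, μ i * ‖⟪b i, v⟫_ℂ‖ ^ 2 := by
    rw [← b.sum_inner_mul_inner v (T v), Complex.re_sum]
    refine Finset.sum_congr rfl fun i _ => ?_
    have h1 : (⟪v, b i⟫_ℂ * ⟪b i, v⟫_ℂ).re = ‖⟪v, b i⟫_ℂ * ⟪b i, v⟫_ℂ‖ :=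
      inner_mul_symm_re_eq_norm (𝕜 := ℂ) v (b i)
    rw [← hT (b i) v, hb, inner_smul_left, Complex.conj_ofReal, mul_left_comm,
      Complex.re_ofReal_mul, h1, norm_mul, norm_inner_symm v (b i)]
    ring
  have e2 : ‖(1 - P) v‖ ^ 2 = ∑ i, ‖⟪b i, (1 - P) v⟫_ℂ‖ ^ 2 := (b.sum_sq_norm_inner_right _).symm
  rw [e1, e2, Finset.mul_sum]
  refine Finset.sum_le_sum fun i _ => ?_
  rw [← inner_projection_left hPp.one_sub]
  by_cases h0 : μ i = 0
  · have : P (b i) = b i := by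
      refine Submodule.starProjection_eq_self_iff.mpr (mem_eigenspace_iff.mpr ?_)
      rw [hb, h0]; simp
    have h1 : (1 - P) (b i) = 0 := by
      rw [sub_apply, this]; simp
    rw [h1, inner_zero_left, h0]; simp
  · have : P (b i) = 0 :=
      starProjection_eigenspace_of_hasEigenvector_ne hT
        (by exact_mod_cast Ne.symm h0) (hb i)
    have h1 : (1 - P) (b i) = b i := by
      rw [sub_apply, this]; simp
    rw [h1]
    exact mul_le_mul_of_nonneg_right (hc _ (hT.hasEigenvalue_eigenvalues rfl i) h0) (sq_nonneg _)

theorem finite_real_eigenvalues (T : E →ₗ[ℂ] E) : {μ : ℝ | HasEigenvalue T (μ : ℂ)}.Finite :=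
  (finite_hasEigenvalue T).preimage Complex.ofReal_injective.injOn

theorem exists_pos_le_of_finite {S : Set ℝ} (hS : S.Finite) :
    ∃ c : ℝ, 0 < c ∧ ∀ μ ∈ S, 0 < μ → c ≤ μ := by
  induction S, hS using Set.Finite.induction_on with
  | empty => exact ⟨1, one_pos, by simp⟩
  | @insert a s _ _ ih =>
    obtain ⟨c, hc, h⟩ := ih
    by_cases ha : 0 < a
    · refine ⟨min a c, lt_min ha hc, fun μ hμ h0 => ?_⟩
      rcases hμ with rfl | hμ
      · exact min_le_left _ _
      · exact (min_le_right _ _).trans (h μ hμ h0)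
    · refine ⟨c, hc, fun μ hμ h0 => ?_⟩
      rcases hμ with rfl | hμ
      · exact absurd h0 ha
      · exact h μ hμ h0

end Spectral

/-! ### Ground states, ground energy and the gap as an operator inequality -/

section Ground

open scoped Classical InnerProductSpace
open Module.End

variable {Γ : Type*} {d : ℕ}

/-- The term `h(X)` as an operator on `ℋ_Λ`, or `0` if `X` is not contained in `Λ`. -/
def term (h : Interaction Γ d) (Λ X : Finset Γ) : HilbertSpace d Λ →L[ℂ] HilbertSpace d Λ :=
  if hX : X ⊆ Λ then embed hX (h X) else 0

theorem term_of_subset (h : Interaction Γ d) {Λ X : Finset Γ} (hX : X ⊆ Λ) :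
    term h Λ X = embed hX (h X) := dif_pos hX

theorem isStarProjection_term {h : Interaction Γ d} (hp : ∀ X, IsStarProjection (h X))
    (Λ X : Finset Γ) : IsStarProjection (term h Λ X) := by
  unfold term
  split_ifs with hX
  · exact (hp X).map (embed hX)
  · exact IsStarProjection.zero _

theorem embed_hamiltonian (h : Interaction Γ d) {A Λ : Finset Γ} (hA : A ⊆ Λ) :
    embed hA (hamiltonian h A) = ∑ X ∈ A.powerset, term h Λ X := by
  rw [hamiltonian, map_sum, ← Finset.sum_attach A.powerset]
  refine Finset.sum_congr rfl fun X _ => ?_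
  rw [embed_extend, term_of_subset]

theorem toOp_hamiltonian (h : Interaction Γ d) (Λ : Finset Γ) :
    toOp (hamiltonian h Λ) = ∑ X ∈ Λ.powerset, term h Λ X := by
  rw [← embed_self, embed_hamiltonian]

theorem re_inner_sum_term {h : Interaction Γ d} (hp : ∀ X, IsStarProjection (h X))
    (Λ : Finset Γ) (S : Finset (Finset Γ)) (v : HilbertSpace d Λ) :
    (⟪v, (∑ X ∈ S, term h Λ X) v⟫_ℂ).re = ∑ X ∈ S, ‖term h Λ X v‖ ^ 2 := by
  rw [sum_apply, inner_sum, Complex.re_sum]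
  exact Finset.sum_congr rfl fun X _ => re_inner_projection (isStarProjection_term hp Λ X) v

theorem isSelfAdjoint_hamiltonian {h : Interaction Γ d} (hp : ∀ X, IsStarProjection (h X))
    (Λ : Finset Γ) : IsSelfAdjoint (hamiltonian h Λ) :=
  isSelfAdjoint_sum _ fun X _ => (hp X.1).isSelfAdjoint.map (extendHom _)

theorem isSymmetric_hamiltonian {h : Interaction Γ d} (hp : ∀ X, IsStarProjection (h X))
    (Λ : Finset Γ) :
    (toOp (hamiltonian h Λ) : HilbertSpace d Λ →ₗ[ℂ] HilbertSpace d Λ).IsSymmetric :=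
  ((isSelfAdjoint_hamiltonian hp Λ).map
    (Matrix.toEuclideanCLM (n := Config d Λ) (𝕜 := ℂ))).isSymmetric

theorem nonneg_of_mem_eigenvalueSet {h : Interaction Γ d} (hp : ∀ X, IsStarProjection (h X))
    {Λ : Finset Γ} {μ : ℝ} (hμ : μ ∈ eigenvalueSet (hamiltonian h Λ)) : 0 ≤ μ := by
  refine eigenvalue_nonneg_of_nonneg (𝕜 := ℂ) hμ fun v => ?_
  change 0 ≤ (⟪v, toOp (hamiltonian h Λ) v⟫_ℂ).re
  rw [toOp_hamiltonian, re_inner_sum_term hp]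
  exact Finset.sum_nonneg fun _ _ => sq_nonneg _

theorem eigenvalueSet_nonempty (hd : 0 < d) {X : Finset Γ} {M : Observable d X}
    (hM : (toOp M : HilbertSpace d X →ₗ[ℂ] HilbertSpace d X).IsSymmetric) :
    (eigenvalueSet M).Nonempty := by
  have : Nonempty (Fin d) := ⟨⟨0, hd⟩⟩
  have hpos : 0 < Module.finrank ℂ (HilbertSpace d X) := Module.finrank_pos
  exact ⟨_, hM.hasEigenvalue_eigenvalues rfl ⟨0, hpos⟩⟩

theorem toOp_groundProjector {X : Finset Γ} (M : Observable d X) :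
    toOp (groundProjector M) = (Module.End.eigenspace
      (toOp M : HilbertSpace d X →ₗ[ℂ] HilbertSpace d X) (groundEnergy M : ℂ)).starProjection :=
  (Matrix.toEuclideanCLM (n := Config d X) (𝕜 := ℂ)).apply_symm_apply _

theorem groundEnergy_mem (hd : 0 < d) {X : Finset Γ} {M : Observable d X}
    (hM : (toOp M : HilbertSpace d X →ₗ[ℂ] HilbertSpace d X).IsSymmetric) :
    groundEnergy M ∈ eigenvalueSet M :=
  (eigenvalueSet_nonempty hd hM).csInf_mem (finite_real_eigenvalues _)

theorem isStarProjection_toOp_iff {X : Finset Γ} {M : Observable d X} :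
    IsStarProjection (toOp M) ↔ IsStarProjection M := by
  let φ := Matrix.toEuclideanCLM (n := Config d X) (𝕜 := ℂ)
  exact ⟨fun h => ⟨φ.injective ((map_mul φ M M).trans h.isIdempotentElem),
    φ.injective ((map_star φ M).trans h.isSelfAdjoint)⟩, fun h => h.map φ⟩

theorem isStarProjection_groundProj (h : Interaction Γ d) (Λ : Finset Γ) :
    IsStarProjection (groundProj h Λ) := by
  rw [← isStarProjection_toOp_iff, groundProj, toOp_groundProjector]
  exact isStarProjection_starProjection

/-- Interactions made of projections whose terms annihilate the ground states. -/
structure IsAnnihilating (h : Interaction Γ d) : Prop where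
  projection : ∀ X : Finset Γ, IsStarProjection (h X)
  extend_mul : ∀ (X Λ : Finset Γ) (hX : X ⊆ Λ), extend hX (h X) * groundProj h Λ = 0

variable {h : Interaction Γ d}

/-- A ground state vector lies in the range of the ground state projector, hence is annihilated by
every term and by their sum. -/
theorem IsAnnihilating.groundEnergy_eq_zero (hh : IsAnnihilating h) (hd : 0 < d) (Λ : Finset Γ) :
    groundEnergy (hamiltonian h Λ) = 0 := by
  have hs := isSymmetric_hamiltonian hh.projection Λ
  obtain ⟨v, hv⟩ := HasEigenvalue.exists_hasEigenvector (groundEnergy_mem hd hs)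
  have hPv : toOp (groundProj h Λ) v = v := by
    rw [groundProj, toOp_groundProjector]
    exact Submodule.starProjection_eq_self_iff.mpr hv.1
  have h0 : hamiltonian h Λ * groundProj h Λ = 0 := by
    rw [hamiltonian, Finset.sum_mul]
    exact Finset.sum_eq_zero fun X _ => hh.extend_mul _ _ _
  have h1 : toOp (hamiltonian h Λ) v = 0 := by
    have : toOp (hamiltonian h Λ * groundProj h Λ) = toOp (hamiltonian h Λ) * toOp (groundProj h Λ) :=
      map_mul (Matrix.toEuclideanCLM (n := Config d Λ) (𝕜 := ℂ)) _ _
    rw [h0] at this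
    have h2 : toOp (0 : Observable d Λ) = 0 :=
      map_zero (Matrix.toEuclideanCLM (n := Config d Λ) (𝕜 := ℂ))
    rw [h2] at this
    have := congrArg (fun T : HilbertSpace d Λ →L[ℂ] HilbertSpace d Λ => T v) this
    simp only [mul_apply_eq_comp, hPv] at this
    exact this.symm
  have h3 := hv.apply_eq_smul
  change toOp (hamiltonian h Λ) v = _ at h3
  rw [h1] at h3
  simpa [hv.2] using h3.symm

theorem IsAnnihilating.toOp_groundProj (hh : IsAnnihilating h) (hd : 0 < d) (Λ : Finset Γ) :
    toOp (groundProj h Λ) = (Module.End.eigenspace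
      (toOp (hamiltonian h Λ) : HilbertSpace d Λ →ₗ[ℂ] HilbertSpace d Λ) 0).starProjection := by
  rw [groundProj, toOp_groundProjector, hh.groundEnergy_eq_zero hd, Complex.ofReal_zero]

/-- The gap as a lower bound of the Hamiltonian on the complement of the ground states. -/
theorem IsAnnihilating.le_gap_iff (hh : IsAnnihilating h) (hd : 0 < d) (Λ : Finset Γ) (c : ℝ) :
    ENNReal.ofReal c ≤ gap h Λ ↔ ∀ v : HilbertSpace d Λ,
      c * ‖(1 - toOp (groundProj h Λ)) v‖ ^ 2 ≤ ∑ X ∈ Λ.powerset, ‖term h Λ X v‖ ^ 2 := by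
  have hs := isSymmetric_hamiltonian hh.projection Λ
  rw [hh.toOp_groundProj hd, gap, hh.groundEnergy_eq_zero hd]
  simp only [le_iInf_iff, sub_zero]
  constructor
  · intro H v
    rw [← re_inner_sum_term hh.projection, ← toOp_hamiltonian]
    refine mul_norm_sq_le_re_inner hs (fun μ hμ h0 => ?_) v
    have hμ0 : 0 ≤ μ := nonneg_of_mem_eigenvalueSet hh.projection hμ
    exact (ENNReal.ofReal_le_ofReal_iff hμ0).mp (H μ ⟨hμ, h0⟩)
  · rintro H μ ⟨hμ, h0⟩
    refine ENNReal.ofReal_le_ofReal ?_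
    obtain ⟨v, hv⟩ := HasEigenvalue.exists_hasEigenvector hμ
    have hv' := hv.apply_eq_smul
    have hP : (Module.End.eigenspace (toOp (hamiltonian h Λ) :
        HilbertSpace d Λ →ₗ[ℂ] HilbertSpace d Λ) 0).starProjection v = 0 :=
      starProjection_eigenspace_of_hasEigenvector_ne hs
        (by exact_mod_cast fun e : (0 : ℝ) = μ => h0 e.symm) hv'
    have := H v
    rw [← re_inner_sum_term hh.projection, ← toOp_hamiltonian, sub_apply, hP, sub_zero,
      one_apply_eq_self] at this
    change toOp (hamiltonian h Λ) v = _ at hv'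
    rw [hv', inner_smul_right, Complex.re_ofReal_mul] at this
    have h2 : (⟪v, v⟫_ℂ).re = ‖v‖ ^ 2 := inner_self_eq_norm_sq (𝕜 := ℂ) v
    rw [h2] at this
    have hpos : 0 < ‖v‖ ^ 2 := by have := norm_pos_iff.mpr hv.2; positivity
    exact le_of_mul_le_mul_right this hpos

/-- There are finitely many eigenvalues, so some positive bound exists, depending on the region. It
serves only to identify the range of `P_A` with the common kernel of the terms inside `A`. -/
theorem IsAnnihilating.exists_le_gap (hh : IsAnnihilating h) (hd : 0 < d) (Λ : Finset Γ) :
    ∃ c : ℝ, 0 < c ∧ ENNReal.ofReal c ≤ gap h Λ := by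
  obtain ⟨c, hc, H⟩ := exists_pos_le_of_finite (finite_real_eigenvalues
    (toOp (hamiltonian h Λ) : HilbertSpace d Λ →ₗ[ℂ] HilbertSpace d Λ))
  refine ⟨c, hc, ?_⟩
  rw [gap, hh.groundEnergy_eq_zero hd]
  simp only [le_iInf_iff, sub_zero]
  rintro μ ⟨hμ, h0⟩
  have hμ0 : 0 ≤ μ := nonneg_of_mem_eigenvalueSet hh.projection hμ
  exact ENNReal.ofReal_le_ofReal (H μ hμ (lt_of_le_of_ne hμ0 (Ne.symm h0)))

end Ground

/-! ### Ground state projectors inside larger regions and their overlap -/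

section Projectors

open scoped Classical InnerProductSpace

variable {Γ : Type*} {d : ℕ} {h : Interaction Γ d}

/-- The extension of observables to a larger region preserves operator inequalities. -/
theorem re_inner_embed_nonneg {A Λ : Finset Γ} (hA : A ⊆ Λ) {M : Observable d A}
    (hM : (toOp M).IsPositive) (v : HilbertSpace d Λ) : 0 ≤ (⟪v, embed hA M v⟫_ℂ).re := by
  -- A positive observable has the form `N* N`, a form preserved by any star homomorphism.
  obtain ⟨S, hS⟩ := CStarAlgebra.nonneg_iff_eq_star_mul_self.mp
    ((ContinuousLinearMap.nonneg_iff_isPositive _).mpr hM)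
  obtain ⟨N, rfl⟩ : ∃ N : Observable d A, toOp N = S :=
    (Matrix.toEuclideanCLM (n := Config d A) (𝕜 := ℂ)).surjective S
  have hM' : M = star N * N := by
    refine (Matrix.toEuclideanCLM (n := Config d A) (𝕜 := ℂ)).injective (hS.trans ?_)
    change _ = toOp (star N * N)
    rw [← embed_self, ← embed_self, map_mul, map_star]
  rw [hM', map_mul, map_star, mul_apply_eq_comp, ContinuousLinearMap.star_eq_adjoint,
    ContinuousLinearMap.adjoint_inner_right]
  exact inner_self_nonneg (𝕜 := ℂ)

theorem term_mul_embed {X A Λ : Finset Γ} (hX : X ⊆ A) (hA : A ⊆ Λ) (M : Observable d A) :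
    term h Λ X * embed hA M = embed hA (extend hX (h X) * M) := by
  rw [map_mul, embed_extend, term_of_subset]

theorem embed_one_sub {A Λ : Finset Γ} (hA : A ⊆ Λ) (M : Observable d A) :
    embed hA (1 - M) = 1 - embed hA M := by
  rw [map_sub, map_one]

/-- The gap of `A` bounds the energy of `A` inside a larger region. -/
theorem IsAnnihilating.le_embed_of_le_gap (hh : IsAnnihilating h) (hd : 0 < d) {A Λ : Finset Γ}
    (hA : A ⊆ Λ) {c : ℝ} (hc : ENNReal.ofReal c ≤ gap h A) (v : HilbertSpace d Λ) :
    c * ‖(1 - embed hA (groundProj h A)) v‖ ^ 2 ≤ ∑ X ∈ A.powerset, ‖term h Λ X v‖ ^ 2 := by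
  have H := (hh.le_gap_iff hd A c).mp hc
  -- The gap of `A` says that `M` is positive on `ℋ_A`; the claim is its positivity after embedding.
  set M : Observable d A := hamiltonian h A - (c : ℂ) • (1 - groundProj h A) with hMdef
  have hP := isStarProjection_groundProj h A
  have e : ∀ {Y : Finset Γ} (hAY : A ⊆ Y) (w : HilbertSpace d Y), (⟪w, embed hAY M w⟫_ℂ).re =
      ∑ X ∈ A.powerset, ‖term h Y X w‖ ^ 2
        - c * ‖(1 - embed hAY (groundProj h A)) w‖ ^ 2 := by
    intro Y hAY w
    have hp' : IsStarProjection (1 - embed hAY (groundProj h A)) := (hP.map (embed hAY)).one_sub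
    rw [hMdef, map_sub, map_smul, embed_one_sub, embed_hamiltonian, sub_apply, inner_sub_right,
      Complex.sub_re, re_inner_sum_term hh.projection, smul_apply,
      inner_smul_right, Complex.re_ofReal_mul, re_inner_projection hp']
  have hMpos : (toOp M).IsPositive := by
    rw [← embed_self, ContinuousLinearMap.isPositive_def']
    refine ⟨?_, fun w => ?_⟩
    · have : IsSelfAdjoint M :=
        (isSelfAdjoint_hamiltonian hh.projection A).sub
          (IsSelfAdjoint.smul (Complex.conj_ofReal c) hP.one_sub.isSelfAdjoint)
      exact this.map (embed _)
    · rw [ContinuousLinearMap.reApplyInnerSelf_apply, inner_re_symm]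
      change 0 ≤ (⟪w, embed (subset_refl A) M w⟫_ℂ).re
      rw [e, embed_self]
      linarith [H w]
  have := re_inner_embed_nonneg hA hMpos v
  rw [e] at this
  linarith

theorem isStarProjection_embed_groundProj (h : Interaction Γ d) {A Λ : Finset Γ} (hA : A ⊆ Λ) :
    IsStarProjection (embed hA (groundProj h A)) :=
  (isStarProjection_groundProj h A).map (embed hA)

theorem IsAnnihilating.term_mul_embed_groundProj (hh : IsAnnihilating h) {X A Λ : Finset Γ}
    (hX : X ⊆ A) (hA : A ⊆ Λ) : term h Λ X * embed hA (groundProj h A) = 0 := by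
  rw [term_mul_embed hX, hh.extend_mul, map_zero]

/-- The range of the embedded ground state projector of `A` contains every vector annihilated by
all terms inside `A`. -/
theorem IsAnnihilating.embed_groundProj_mul (hh : IsAnnihilating h) (hd : 0 < d) {A Λ : Finset Γ}
    (hA : A ⊆ Λ) {R : HilbertSpace d Λ →L[ℂ] HilbertSpace d Λ}
    (hR : ∀ X ⊆ A, term h Λ X * R = 0) : embed hA (groundProj h A) * R = R := by
  obtain ⟨c, hc, hgap⟩ := hh.exists_le_gap hd A
  ext1 v
  have h1 := hh.le_embed_of_le_gap hd hA hgap (R v)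
  have h2 : ∑ X ∈ A.powerset, ‖term h Λ X (R v)‖ ^ 2 = 0 := by
    refine Finset.sum_eq_zero fun X hX => ?_
    rw [← mul_apply_eq_comp, hR X (Finset.mem_powerset.mp hX)]; simp
  rw [h2] at h1
  have h3 : ‖(1 - embed hA (groundProj h A)) (R v)‖ ^ 2 ≤ 0 := by
    by_contra hlt
    push Not at hlt
    exact absurd h1 (not_le.mpr (mul_pos hc hlt))
  have h4 : (1 - embed hA (groundProj h A)) (R v) = 0 := by
    have := pow_eq_zero_iff (two_ne_zero) |>.mp (le_antisymm h3 (sq_nonneg _))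
    exact norm_eq_zero.mp this
  rw [sub_apply, one_apply_eq_self, sub_eq_zero] at h4
  exact h4.symm

theorem IsAnnihilating.embed_mul_toOp_groundProj (hh : IsAnnihilating h) (hd : 0 < d)
    {A Λ : Finset Γ} (hA : A ⊆ Λ) :
    embed hA (groundProj h A) * toOp (groundProj h Λ) = toOp (groundProj h Λ) := by
  refine hh.embed_groundProj_mul hd hA fun X hX => ?_
  rw [← embed_self]
  exact hh.term_mul_embed_groundProj (hX.trans hA) _

/-- `P_A` as an operator on `ℋ_{A ∪ B}`. -/
def projL (h : Interaction Γ d) (A B : Finset Γ) :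
    HilbertSpace d (A ∪ B) →L[ℂ] HilbertSpace d (A ∪ B) :=
  embed Finset.subset_union_left (groundProj h A)

/-- `P_B` as an operator on `ℋ_{A ∪ B}`. -/
def projR (h : Interaction Γ d) (A B : Finset Γ) :
    HilbertSpace d (A ∪ B) →L[ℂ] HilbertSpace d (A ∪ B) :=
  embed Finset.subset_union_right (groundProj h B)

theorem overlap_eq (h : Interaction Γ d) (A B : Finset Γ) :
    overlap h A B = ‖(projL h A B - toOp (groundProj h (A ∪ B))) *
      (projR h A B - toOp (groundProj h (A ∪ B)))‖ := by
  let φ := Matrix.toEuclideanCLM (n := Config d (A ∪ B)) (𝕜 := ℂ)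
  change ‖φ _‖ = ‖(φ _ - φ _) * (φ _ - φ _)‖
  rw [map_mul, map_sub, map_sub]
  rfl

theorem IsAnnihilating.overlap_eq_norm_mul_sub (hh : IsAnnihilating h) (hd : 0 < d)
    (A B : Finset Γ) :
    overlap h A B = ‖projL h A B * projR h A B - toOp (groundProj h (A ∪ B))‖ := by
  have hP : IsStarProjection (toOp (groundProj h (A ∪ B))) :=
    isStarProjection_toOp_iff.mpr (isStarProjection_groundProj h _)
  have hB : IsStarProjection (projR h A B) := isStarProjection_embed_groundProj h _
  have h1 : projL h A B * toOp (groundProj h (A ∪ B)) = toOp (groundProj h (A ∪ B)) :=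
    hh.embed_mul_toOp_groundProj hd _
  have h2 : projR h A B * toOp (groundProj h (A ∪ B)) = toOp (groundProj h (A ∪ B)) :=
    hh.embed_mul_toOp_groundProj hd _
  have h3 : toOp (groundProj h (A ∪ B)) * projR h A B = toOp (groundProj h (A ∪ B)) := by
    have := congrArg star h2
    rwa [star_mul, hB.isSelfAdjoint.star_eq, hP.isSelfAdjoint.star_eq] at this
  have h4 : toOp (groundProj h (A ∪ B)) * toOp (groundProj h (A ∪ B))
      = toOp (groundProj h (A ∪ B)) := hP.isIdempotentElem
  rw [overlap_eq, sub_mul, mul_sub, mul_sub, h1, h3, h4]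
  congr 1
  abel

/-- A crude bound, needed only to keep the first few `δ_k` finite. -/
theorem IsAnnihilating.overlap_le_two (hh : IsAnnihilating h) (hd : 0 < d) (A B : Finset Γ) :
    overlap h A B ≤ 2 := by
  rw [hh.overlap_eq_norm_mul_sub hd]
  have h1 : ‖projL h A B‖ ≤ 1 := norm_projection_le_one (isStarProjection_embed_groundProj h _)
  have h2 : ‖projR h A B‖ ≤ 1 := norm_projection_le_one (isStarProjection_embed_groundProj h _)
  have h3 : ‖toOp (groundProj h (A ∪ B))‖ ≤ 1 :=
    norm_projection_le_one (isStarProjection_toOp_iff.mpr (isStarProjection_groundProj h _))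
  have h4 := norm_sub_le (projL h A B * projR h A B) (toOp (groundProj h (A ∪ B)))
  have h5 := norm_mul_le (projL h A B) (projR h A B)
  have h6 : ‖projL h A B‖ * ‖projR h A B‖ ≤ 1 * 1 :=
    mul_le_mul h1 h2 (norm_nonneg _) zero_le_one
  linarith

theorem embed_groundProj_of_eq (h : Interaction Γ d) {A Λ : Finset Γ} (hA : A ⊆ Λ)
    (e : A = Λ) : embed hA (groundProj h A) = toOp (groundProj h Λ) := by
  subst e
  rw [embed_self]

theorem overlap_eq_zero_of_subset (h : Interaction Γ d) {A B : Finset Γ}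
    (hAB : A ∪ B = A ∨ A ∪ B = B) : overlap h A B = 0 := by
  rw [overlap_eq]
  rcases hAB with e | e
  · rw [projL, embed_groundProj_of_eq h _ e.symm, sub_self, zero_mul, norm_zero]
  · rw [projR, embed_groundProj_of_eq h _ e.symm, sub_self, mul_zero, norm_zero]

/-- Non-interacting disjoint regions have overlap zero. -/
theorem IsAnnihilating.overlap_eq_zero_of_disjoint (hh : IsAnnihilating h) (hd : 0 < d)
    {A B : Finset Γ} (hAB : Disjoint A B)
    (hloc : ∀ X ⊆ A ∪ B, ¬ X ⊆ A → ¬ X ⊆ B → h X = 0) : overlap h A B = 0 := by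
  have hc : projL h A B * projR h A B = projR h A B * projL h A B :=
    (embed_commute _ _ hAB _ _).eq
  have hA : IsStarProjection (projL h A B) := isStarProjection_embed_groundProj h _
  have hB : IsStarProjection (projR h A B) := isStarProjection_embed_groundProj h _
  have hP : IsStarProjection (toOp (groundProj h (A ∪ B))) :=
    isStarProjection_toOp_iff.mpr (isStarProjection_groundProj h _)
  have h1 : projL h A B * toOp (groundProj h (A ∪ B)) = toOp (groundProj h (A ∪ B)) :=
    hh.embed_mul_toOp_groundProj hd _
  have h2 : projR h A B * toOp (groundProj h (A ∪ B)) = toOp (groundProj h (A ∪ B)) :=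
    hh.embed_mul_toOp_groundProj hd _
  -- Every nonzero term lies in `A` or in `B`, and the commuting projections allow the matching one
  -- to be put in front; so the range of `P_A P_B` is killed by all terms.
  have h3 : toOp (groundProj h (A ∪ B)) * (projL h A B * projR h A B)
      = projL h A B * projR h A B := by
    rw [← embed_self]
    refine hh.embed_groundProj_mul hd _ fun X hX => ?_
    by_cases hXA : X ⊆ A
    · rw [projL, ← mul_assoc, hh.term_mul_embed_groundProj hXA, zero_mul]
    · by_cases hXB : X ⊆ B
      · rw [hc, projR, ← mul_assoc, hh.term_mul_embed_groundProj hXB, zero_mul]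
      · rw [term_of_subset h hX, hloc X hX hXA hXB, map_zero, zero_mul]
  have h4 : projL h A B * projR h A B * toOp (groundProj h (A ∪ B)) =
      toOp (groundProj h (A ∪ B)) := by rw [mul_assoc, h2, h1]
  have h5 : toOp (groundProj h (A ∪ B)) * (projL h A B * projR h A B) =
      toOp (groundProj h (A ∪ B)) := by
    have := congrArg star h4
    rwa [star_mul, star_mul, hA.isSelfAdjoint.star_eq, hB.isSelfAdjoint.star_eq,
      hP.isSelfAdjoint.star_eq, ← hc] at this
  rw [hh.overlap_eq_norm_mul_sub hd, ← h3, h5, sub_self, norm_zero]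

theorem term_commute_of_disjoint {X Y Λ : Finset Γ} (hXY : Disjoint X Y) :
    Commute (term h Λ X) (term h Λ Y) := by
  unfold term
  split_ifs
  · exact embed_commute _ _ hXY _ _
  · exact Commute.zero_right _
  · exact Commute.zero_left _
  · exact Commute.zero_left _

/-- A non-zero interaction forces the existence of a region with gap at most `1`. -/
theorem IsAnnihilating.exists_gap_le_one (hh : IsAnnihilating h) (hd : 0 < d)
    (h0 : ∃ X, h X ≠ 0) : ∃ Λ, gap h Λ ≤ 1 := by
  -- For a minimal `X` with `h X ≠ 0` the Hamiltonian of `X` is the projection `h X` itself, which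
  -- has the eigenvalue `1`.
  obtain ⟨X, hX, hmin⟩ := WellFounded.has_min (r := ((· < ·) : Finset Γ → Finset Γ → Prop))
    wellFounded_lt {X | h X ≠ 0} h0
  have hlt : ∀ Y, Y ⊆ X → Y ≠ X → h Y = 0 := fun Y hY hne => by
    by_contra hY0
    exact hmin Y hY0 (lt_of_le_of_ne hY hne)
  have hham : hamiltonian h X = h X := by
    rw [hamiltonian, Finset.sum_eq_single ⟨X, Finset.mem_powerset_self X⟩]
    · exact extend_self _
    · intro Y _ hY
      rw [hlt Y.1 (Finset.mem_powerset.mp Y.2) fun e => hY (Subtype.ext e)]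
      exact map_zero (extendHom _)
    · intro hn; exact absurd (Finset.mem_attach _ _) hn
  have hproj : IsStarProjection (toOp (h X)) := isStarProjection_toOp_iff.mpr (hh.projection X)
  have hne : toOp (h X) ≠ 0 := fun e =>
    hX ((Matrix.toEuclideanCLM (n := Config d X) (𝕜 := ℂ)).injective (e.trans (map_zero _).symm))
  obtain ⟨v, hv⟩ : ∃ v, toOp (h X) v ≠ 0 := by
    by_contra hcon
    push Not at hcon
    exact hne (ContinuousLinearMap.ext hcon)
  refine ⟨X, ?_⟩
  have hmem : (1 : ℝ) ∈ eigenvalueSet (hamiltonian h X) := by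
    rw [hham]
    refine Module.End.hasEigenvalue_of_hasEigenvector (x := toOp (h X) v) ⟨?_, hv⟩
    rw [Module.End.mem_eigenspace_iff]
    simpa using projection_apply_apply hproj v
  rw [gap, hh.groundEnergy_eq_zero hd]
  refine (iInf₂_le (1 : ℝ) ⟨hmem, one_ne_zero⟩).trans ?_
  simp

end Projectors

/-! ### From a spectral gap to exponential decay of the overlap -/

section Decay

open scoped Classical

variable {Γ : Type*} [MetricSpace Γ] {d : ℕ} {h : Interaction Γ d} {r : ℝ}

theorem IsFrustrationFree.isAnnihilating (hf : IsFrustrationFree r h) : IsAnnihilating h where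
  projection := hf.projection
  extend_mul X Λ hX := by
    rw [hf.frustration_free X Λ hX, hf.energy_zero, Complex.ofReal_zero, zero_smul]

theorem IsFrustrationFree.dist_le (hf : IsFrustrationFree r h) {X : Finset Γ} (hX : h X ≠ 0)
    {x y : Γ} (hx : x ∈ X) (hy : y ∈ X) : dist x y ≤ r := by
  have h1 : Metric.diam (X : Set Γ) ≤ r := by
    by_contra hlt
    exact hX (hf.finite_range X (not_le.mp hlt))
  exact (Metric.dist_le_diam_of_mem X.finite_toSet.isBounded hx hy).trans h1

theorem edist_ge_regionDist {S T : Finset Γ} {x y : Γ} (hx : x ∈ S) (hy : y ∈ T) :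
    regionDist S T ≤ edist x y :=
  (iInf₂_le x hx).trans (iInf₂_le y hy)

theorem dist_ge_of_regionDist {S T : Finset Γ} {l : ℝ} (hl : ENNReal.ofReal l ≤ regionDist S T)
    {x y : Γ} (hx : x ∈ S) (hy : y ∈ T) : l ≤ dist x y := by
  have := hl.trans (edist_ge_regionDist hx hy)
  rw [edist_dist] at this
  exact (ENNReal.ofReal_le_ofReal_iff dist_nonneg).mp this

/-- Each active term fails to commute with a bounded number of active terms. -/
theorem IsFrustrationFree.card_not_commute_le (hf : IsFrustrationFree r h) {N : ℕ}
    (hN : ∀ (x : Γ) (S : Finset Γ), (∀ y ∈ S, dist y x ≤ 2 * r) → S.card ≤ N)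
    (Λ X : Finset Γ) (hX : h X ≠ 0) :
    (((Λ.powerset.filter fun Y => h Y ≠ 0)).filter
      fun Y => ¬ Commute (term h Λ X) (term h Λ Y)).card ≤ 2 ^ N := by
  rcases X.eq_empty_or_nonempty with rfl | ⟨x, hx⟩
  · rw [Finset.filter_false_of_mem]
    · simp
    · exact fun Y _ => not_not.mpr (term_commute_of_disjoint (Finset.disjoint_empty_left Y))
  -- A region that fails to commute with `X` meets it, so it lies in the ball of radius `2r` about
  -- `x`, which has at most `2 ^ N` subsets in `Λ`.
  · refine (Finset.card_le_card (t := (Λ.filter fun y => dist y x ≤ 2 * r).powerset) ?_).trans ?_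
    · intro Y hY
      rw [Finset.mem_filter, Finset.mem_filter, Finset.mem_powerset] at hY
      obtain ⟨⟨hYΛ, hY0⟩, hYc⟩ := hY
      have hnd : ¬ Disjoint X Y := fun hd => hYc (term_commute_of_disjoint hd)
      obtain ⟨z, hzX, hzY⟩ := Finset.not_disjoint_iff.mp hnd
      rw [Finset.mem_powerset]
      intro y hy
      rw [Finset.mem_filter]
      refine ⟨hYΛ hy, ?_⟩
      have h1 := hf.dist_le hY0 hy hzY
      have h2 := hf.dist_le hX hzX hx
      linarith [dist_triangle y z x]
    · rw [Finset.card_powerset]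
      exact Nat.pow_le_pow_right (by norm_num)
        (hN x _ fun y hy => (Finset.mem_filter.mp hy).2)

/-- `P_Λ` is approximated by `n + 1` layers. The cut between the part given to `P_A` and the part
given to `P_B` moves by `r` from layer to layer, so that the `A` parts can be pulled past the
earlier `B` parts; the overlap has room for `n + 1` such shifts. -/
theorem IsFrustrationFree.overlap_le_pow (hf : IsFrustrationFree r h) (hd : 0 < d) {N : ℕ}
    (hN : ∀ (x : Γ) (S : Finset Γ), (∀ y ∈ S, dist y x ≤ 2 * r) → S.card ≤ N)
    {A B : Finset Γ} {c l : ℝ} (hc : 0 < c) (hgap : ENNReal.ofReal c ≤ gap h (A ∪ B))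
    (hl : overlapSize A B = ENNReal.ofReal l) (n : ℕ) (hn : (n + 1 : ℕ) * r < l) :
    overlap h A B ≤ (1 / Real.sqrt (1 + c / ((2 ^ N : ℕ) : ℝ) ^ 2)) ^ (n + 1) := by
  have hh := hf.isAnnihilating
  set Λ := A ∪ B with hΛ
  set P := toOp (groundProj h Λ) with hPdef
  have hP : IsStarProjection P := isStarProjection_toOp_iff.mpr (isStarProjection_groundProj h Λ)
  set q := 1 / Real.sqrt (1 + c / ((2 ^ N : ℕ) : ℝ) ^ 2) with hq
  have hne : ((Λ \ A).Nonempty ∧ (Λ \ B).Nonempty) := by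
    constructor
    · by_contra hcon
      rw [Finset.not_nonempty_iff_eq_empty] at hcon
      rw [overlapSize, ← hΛ, hcon] at hl
      simp [regionDist] at hl
    · by_contra hcon
      rw [Finset.not_nonempty_iff_eq_empty] at hcon
      rw [overlapSize, ← hΛ, hcon] at hl
      simp [regionDist] at hl
  -- The distance to `Λ \ B` vanishes off `B` and is at least `l` off `A`. The thresholds `t j`
  -- decrease from `l - r` in steps of `r` and stay positive for `j ≤ n`.
  let f : Γ → ℝ := fun x => Metric.infDist x ((Λ \ B : Finset Γ) : Set Γ)
  have hflip : ∀ x y, f x ≤ f y + dist x y := fun x y => Metric.infDist_le_infDist_add_dist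
  have hfzero : ∀ x ∈ Λ \ B, f x = 0 := fun x hx => Metric.infDist_zero_of_mem (by exact_mod_cast hx)
  have hfl : ∀ x ∈ Λ \ A, l ≤ f x := fun x hx => by
    refine (Metric.le_infDist (by exact_mod_cast hne.2)).mpr fun y hy => ?_
    exact dist_ge_of_regionDist (S := Λ \ A) (T := Λ \ B) hl.ge hx (by exact_mod_cast hy)
  let S : Finset (Finset Γ) := Λ.powerset.filter fun Y => h Y ≠ 0
  let t : ℕ → ℝ := fun j => l - (j + 1) * r
  let p : ℕ → Finset Γ → Prop := fun j X => ∃ x ∈ X, f x < t j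
  let lU : ℕ → List (Finset Γ) := fun j => (S.filter (p j)).toList
  let lV : ℕ → List (Finset Γ) := fun j => (S.filter fun X => ¬ p j X).toList
  let Q : Finset Γ → HilbertSpace d Λ →L[ℂ] HilbertSpace d Λ := term h Λ
  let U : ℕ → HilbertSpace d Λ →L[ℂ] HilbertSpace d Λ := fun j => ((lU j).map fun X => 1 - Q X).prod
  let V : ℕ → HilbertSpace d Λ →L[ℂ] HilbertSpace d Λ := fun j => ((lV j).map fun X => 1 - Q X).prod
  have hUV : ∀ j, U j * V j = (((lU j) ++ (lV j)).map fun X => 1 - Q X).prod := fun j => by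
    rw [List.map_append, List.prod_append]
  have hmemU : ∀ j X, X ∈ lU j ↔ X ∈ S ∧ p j X := fun j X => by
    simp only [lU, Finset.mem_toList, Finset.mem_filter]
  have hmemV : ∀ j X, X ∈ lV j ↔ X ∈ S ∧ ¬ p j X := fun j X => by
    simp only [lV, Finset.mem_toList, Finset.mem_filter]
  have hmemS : ∀ {X}, X ∈ S ↔ X ⊆ Λ ∧ h X ≠ 0 := fun {X} => by
    simp only [S, Finset.mem_filter, Finset.mem_powerset]
  have hfin : ∀ j, ((lU j) ++ (lV j)).toFinset = S := fun j => by
    ext X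
    rw [List.mem_toFinset, List.mem_append, hmemU, hmemV, ← and_or_left, and_iff_left (em _)]
  have hmem : ∀ j X, X ∈ (lU j) ++ (lV j) → X ∈ S := fun j X hX => by
    rw [← hfin j]; exact List.mem_toFinset.mpr hX
  have hnodup : ∀ j, ((lU j) ++ (lV j)).Nodup := fun j => by
    refine List.nodup_append'.mpr ⟨Finset.nodup_toList _, Finset.nodup_toList _, ?_⟩
    intro X h1 h2
    exact ((hmemV j X).mp h2).2 ((hmemU j X).mp h1).2
  have hQproj : ∀ X, IsStarProjection (Q X) := isStarProjection_term hh.projection Λ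
  have hQP : ∀ X ∈ S, Q X * P = 0 := fun X hX => by
    rw [hPdef, ← embed_self]
    exact hh.term_mul_embed_groundProj (hmemS.mp hX).1 _
  have hgap' : ∀ v : HilbertSpace d Λ, c * ‖(1 - P) v‖ ^ 2 ≤ ∑ X ∈ S, ‖Q X v‖ ^ 2 := fun v => by
    refine ((hh.le_gap_iff hd Λ c).mp hgap v).trans_eq ?_
    refine (Finset.sum_subset (Finset.filter_subset _ _) fun X hX hXS => ?_).symm
    have h0 : h X = 0 := by
      by_contra h0
      exact hXS (hmemS.mpr ⟨Finset.mem_powerset.mp hX, h0⟩)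
    change ‖term h Λ X v‖ ^ 2 = 0
    rw [term_of_subset h (Finset.mem_powerset.mp hX), h0, map_zero]
    simp
  have hstep : ∀ j, ‖U j * V j - P‖ ≤ q := fun j => by
    rw [hUV]
    refine norm_prod_sub_le Q (2 ^ N) (by positivity) _ (hnodup j) (fun X _ => hQproj X) ?_ hP
      (fun X hX => hQP X (hmem j X hX)) hc ?_
    · intro X hX
      rw [hfin]
      exact hf.card_not_commute_le hN Λ X (hmemS.mp (hmem j X hX)).2
    · rw [hfin]; exact hgap'
  have hLP : ∀ j, U j * V j * P = P := fun j => by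
    rw [hUV]; exact prod_one_sub_mul Q P _ fun X hX => hQP X (hmem j X hX)
  have hPL : ∀ j, P * (U j * V j) = P := fun j => by
    rw [hUV]
    exact mul_prod_one_sub Q P _ fun X hX =>
      mul_eq_zero_symm hP (hQproj X) (hQP X (hmem j X hX))
  have hbound := norm_prod_range_sub_le (fun j => U j * V j) hP hLP hPL hstep n
  have hr : ∀ {X}, X ∈ S → ∀ {x y}, x ∈ X → y ∈ X → dist x y ≤ r := fun hX x y hx hy =>
    hf.dist_le (hmemS.mp hX).2 hx hy
  have hcomm : ∀ i j, i < j → j < n + 1 → Commute (V i) (U j) := by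
    intro i j hij _
    refine Commute.list_prod_left _ _ fun a ha => ?_
    refine Commute.list_prod_right _ _ fun b hb => ?_
    obtain ⟨X, hX, rfl⟩ := List.mem_map.mp ha
    obtain ⟨Y, hY, rfl⟩ := List.mem_map.mp hb
    rw [hmemV] at hX
    rw [hmemU] at hY
    -- On `X` the function `f` is at least `t i`, while on `Y` it is below `t j + r ≤ t i`.
    have hdis : Disjoint X Y := by
      rw [Finset.disjoint_left]
      intro z hzX hzY
      obtain ⟨y, hy, hfy⟩ := hY.2
      have h1 : t i ≤ f z := by
        by_contra hlt
        exact hX.2 ⟨z, hzX, not_le.mp hlt⟩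
      have h2 := hflip z y
      have h3 := hr hY.1 hzY hy
      have h4 : (i : ℝ) + 1 ≤ j := by exact_mod_cast hij
      have h5 : 0 ≤ r := dist_nonneg.trans h3
      have h6 : (j + 1) * r ≥ (i + 1) * r + r := by nlinarith
      simp only [t] at h1 hfy
      linarith
    have hXY : Commute (Q X) (Q Y) := term_commute_of_disjoint hdis
    exact (Commute.sub_left (Commute.one_left _) ((Commute.sub_right (Commute.one_right _) hXY)))
  rw [prod_mul_prod_of_commute U V (n + 1) hcomm] at hbound
  have hA : IsStarProjection (projL h A B) := isStarProjection_embed_groundProj h _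
  have hB : IsStarProjection (projR h A B) := isStarProjection_embed_groundProj h _
  -- A term of `U j` has `f < t j + r ≤ l` throughout, so it lies in `A`. In the same way a term of
  -- `V j` has `f ≥ t j > 0` and lies in `B`.
  have hAU : ∀ j, projL h A B * U j = projL h A B := fun j => by
    refine mul_prod_one_sub Q _ _ fun X hX => ?_
    rw [hmemU] at hX
    refine mul_eq_zero_symm hA (hQproj X) (hh.term_mul_embed_groundProj ?_ _)
    intro x hx
    by_contra hxA
    have h1 := hfl x (Finset.mem_sdiff.mpr ⟨(hmemS.mp hX.1).1 hx, hxA⟩)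
    obtain ⟨y, hy, hfy⟩ := hX.2
    have h2 := hflip x y
    have h3 := hr hX.1 hx hy
    have h5 : 0 ≤ r := dist_nonneg.trans h3
    have h6 : (j + 1) * r ≥ r := by nlinarith [(Nat.cast_nonneg j : (0 : ℝ) ≤ j)]
    simp only [t] at hfy
    linarith
  have hVB : ∀ j, j < n + 1 → V j * projR h A B = projR h A B := fun j hj => by
    refine prod_one_sub_mul Q _ _ fun X hX => ?_
    rw [hmemV] at hX
    refine hh.term_mul_embed_groundProj ?_ _
    intro x hx
    by_contra hxB
    have h1 := hfzero x (Finset.mem_sdiff.mpr ⟨(hmemS.mp hX.1).1 hx, hxB⟩)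
    have h5 : 0 ≤ r := dist_nonneg.trans (hr hX.1 hx hx)
    have h4 : ((j : ℝ) + 1) ≤ (n + 1 : ℕ) := by exact_mod_cast hj
    refine hX.2 ⟨x, hx, ?_⟩
    have h6 : (j + 1) * r ≤ (n + 1 : ℕ) * r := mul_le_mul_of_nonneg_right h4 h5
    simp only [t]
    rw [h1]
    linarith
  have hAprod : ∀ m, projL h A B * ((List.range m).map U).prod = projL h A B := fun m => by
    induction m with
    | zero => simp
    | succ m ih => rw [List.prod_range_succ, ← mul_assoc, ih, hAU]
  have hBprod : ∀ m, m ≤ n + 1 → ((List.range m).map V).prod * projR h A B = projR h A B :=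
      fun m => by
    induction m with
    | zero => simp
    | succ m ih =>
      intro hm
      rw [List.prod_range_succ, mul_assoc, hVB m hm, ih (Nat.le_of_succ_le hm)]
  have h1 : projL h A B * P = P := hh.embed_mul_toOp_groundProj hd _
  have h2 : projR h A B * P = P := hh.embed_mul_toOp_groundProj hd _
  have h3 : P * projR h A B = P := by
    have := congrArg star h2
    rwa [star_mul, hB.isSelfAdjoint.star_eq, hP.isSelfAdjoint.star_eq] at this
  have e : projL h A B * projR h A B - P = projL h A B *
      (((List.range (n + 1)).map U).prod * ((List.range (n + 1)).map V).prod - P)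
        * projR h A B := by
    rw [mul_sub, sub_mul, ← mul_assoc, hAprod, mul_assoc, hBprod _ le_rfl, h1, h3]
  rw [hh.overlap_eq_norm_mul_sub hd, ← hPdef, e]
  refine (norm_mul_le _ _).trans ?_
  refine (mul_le_of_le_one_right (norm_nonneg _) (norm_projection_le_one hB)).trans ?_
  refine (norm_mul_le _ _).trans ?_
  exact (mul_le_of_le_one_left (norm_nonneg _) (norm_projection_le_one hA)).trans hbound

/-- Lets a large exponent be traded for a larger constant: enlarging `g` by `2 ^ ⌈r⌉₊` compensates
for having about `l / r` layers instead of `l`. -/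
theorem one_add_pow_le {z : ℝ} (h0 : 0 ≤ z) (h1 : z ≤ 1) (k : ℕ) :
    (1 + z) ^ k ≤ 1 + (2 ^ k - 1) * z := by
  induction k with
  | zero => simp
  | succ k ih =>
    have h2 : (1 : ℝ) ≤ 2 ^ k := one_le_pow₀ (by norm_num)
    have h3 : (2 ^ k - 1) * z * z ≤ (2 ^ k - 1) * z * 1 :=
      mul_le_mul_of_nonneg_left h1 (mul_nonneg (by linarith) h0)
    calc (1 + z) ^ (k + 1) = (1 + z) ^ k * (1 + z) := pow_succ _ _
      _ ≤ (1 + (2 ^ k - 1) * z) * (1 + z) := mul_le_mul_of_nonneg_right ih (by linarith)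
      _ ≤ _ := by rw [pow_succ]; nlinarith

/-- Exponential decay of the overlap when the gap is uniform. -/
theorem IsFrustrationFree.overlap_le_rpow (hf : IsFrustrationFree r h) (hr : 0 < r) (hd : 0 < d)
    {N : ℕ} (hN : ∀ (x : Γ) (S : Finset Γ), (∀ y ∈ S, dist y x ≤ 2 * r) → S.card ≤ N)
    {c : ℝ} (hc : 0 < c) (hgap : ∀ Λ, ENNReal.ofReal c ≤ gap h Λ) {A B : Finset Γ} {l : ℝ}
    (hrl : r < l) (hl : overlapSize A B = ENNReal.ofReal l) :
    overlap h A B ≤ 1 / (1 + c / ((2 : ℝ) ^ N * 2 ^ ⌈r⌉₊) ^ 2) ^ (l / 2) := by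
  have hh := hf.isAnnihilating
  have hG0 : 0 < ((2 : ℝ) ^ N * 2 ^ ⌈r⌉₊) ^ 2 := by positivity
  by_cases hz : ∃ X, h X ≠ 0
  · have hc1 : c ≤ 1 := by
      obtain ⟨Λ, hΛ⟩ := hh.exists_gap_le_one hd hz
      have := (hgap Λ).trans hΛ
      rwa [ENNReal.ofReal_le_one] at this
    -- The largest `n` with `(n + 1) r < l`. As `l ≤ (n + 2) r ≤ 2 (n + 1) r`, the number of layers
    -- times `⌈r⌉₊` is at least `l / 2`.
    obtain ⟨n, hn⟩ : ∃ n : ℕ, ⌈l / r⌉₊ = n + 2 := by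
      have : 1 < ⌈l / r⌉₊ := Nat.lt_ceil.mpr (by rw [Nat.cast_one]; exact (one_lt_div hr).mpr hrl)
      exact ⟨⌈l / r⌉₊ - 2, by omega⟩
    have hn1 : (n + 1 : ℕ) * r < l := by
      have : n + 1 < ⌈l / r⌉₊ := by omega
      exact (lt_div_iff₀ hr).mp (Nat.lt_ceil.mp this)
    have hn2 : l ≤ (n + 2 : ℕ) * r := by
      rw [← hn]; exact (div_le_iff₀ hr).mp (Nat.le_ceil _)
    refine (hf.overlap_le_pow hd hN hc (hgap _) hl n hn1).trans ?_
    set y := c / ((2 ^ N : ℕ) : ℝ) ^ 2 with hy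
    set z := c / ((2 : ℝ) ^ N * 2 ^ ⌈r⌉₊) ^ 2 with hz
    have hz0 : 0 < z := by positivity
    have hG1 : (1 : ℝ) ≤ ((2 : ℝ) ^ N * 2 ^ ⌈r⌉₊) ^ 2 :=
      one_le_pow₀ (one_le_mul_of_one_le_of_one_le (one_le_pow₀ (by norm_num))
        (one_le_pow₀ (by norm_num)))
    have hz1 : z ≤ 1 := (div_le_self hc.le hG1).trans hc1
    have hyz : y = 2 ^ (2 * ⌈r⌉₊) * z := by
      rw [hy, hz]; push_cast
      field_simp
      ring
    have key : (1 + z) ^ (2 * ⌈r⌉₊) ≤ 1 + y := by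
      refine (one_add_pow_le hz0.le hz1 _).trans ?_
      rw [hyz]; linarith
    have key2 : (1 + z) ^ ⌈r⌉₊ ≤ Real.sqrt (1 + y) := by
      refine Real.le_sqrt_of_sq_le ?_
      rw [← pow_mul, mul_comm]; exact key
    rw [one_div_pow]
    refine one_div_le_one_div_of_le (Real.rpow_pos_of_pos (by linarith) _) ?_
    refine le_trans ?_ (pow_le_pow_left₀ (by positivity) key2 (n + 1))
    rw [← pow_mul, ← Real.rpow_natCast]
    refine Real.rpow_le_rpow_of_exponent_le (by linarith) ?_
    push_cast at hn2 ⊢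
    have h1 : r ≤ ⌈r⌉₊ := Nat.le_ceil r
    have h2 : (n + 1 : ℝ) * r ≤ (n + 1 : ℝ) * ⌈r⌉₊ := by gcongr
    have h3 : (0 : ℝ) ≤ n * r := by positivity
    nlinarith
  -- Without interaction there may be no eigenvalue bounding `c` by `1`, but all ground state
  -- projectors are the identity.
  · push Not at hz
    have hone : ∀ {Y Λ : Finset Γ} (hY : Y ⊆ Λ), embed hY (groundProj h Y) = 1 := by
      intro Y Λ hY
      have := hh.embed_groundProj_mul hd hY (R := 1) fun X hX => by
        rw [term_of_subset h (hX.trans hY), hz, map_zero, zero_mul]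
      rwa [mul_one] at this
    rw [hh.overlap_eq_norm_mul_sub hd, ← embed_self, projL, projR, hone, hone, hone, mul_one,
      sub_self, norm_zero]
    have hz0 : 0 ≤ c / ((2 : ℝ) ^ N * 2 ^ ⌈r⌉₊) ^ 2 := by positivity
    positivity

theorem conditionA_of_bound {c G : ℝ} (hc : 0 < c) (hG : 0 < G)
    (H : OverlapBound r h fun l => 1 / (1 + c / G ^ 2) ^ (l / 2)) :
    ConditionA r h fun l => 1 / (1 + c / G ^ 2) ^ (l / 2) := by
  have hz : 0 < c / G ^ 2 := by positivity
  have h1 : 1 < Real.sqrt (1 + c / G ^ 2) := by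
    rw [Real.lt_sqrt (by norm_num)]; linarith
  refine ⟨fun l _ => by positivity, ⟨1, (Real.sqrt (1 + c / G ^ 2))⁻¹, one_pos,
    by positivity, inv_lt_one_of_one_lt₀ h1, fun l _ => ?_⟩, H⟩
  have e : Real.sqrt (1 + c / G ^ 2) ^ l = (1 + c / G ^ 2) ^ (l / 2) := by
    rw [Real.sqrt_eq_rpow, ← Real.rpow_mul (by positivity), one_div, inv_mul_eq_div]
  rw [one_mul, Real.inv_rpow (Real.sqrt_nonneg _), e]
  exact (one_div _).le

end Decay

/-! ### Lower bounds on the gap from decompositions -/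

section Recursion

open scoped Classical

variable {Γ : Type*} {d : ℕ} {h : Interaction Γ d}

/-- The gap inequality for one decomposition of a region. -/
theorem IsAnnihilating.energy_ge_of_union (hh : IsAnnihilating h) (hd : 0 < d) {Λ A B : Finset Γ}
    (hΛ : Λ = A ∪ B) {c : ℝ} (hc : 0 ≤ c) (hA : ENNReal.ofReal c ≤ gap h A)
    (hB : ENNReal.ofReal c ≤ gap h B) (v : HilbertSpace d Λ) :
    c * (1 - overlap h A B) * ‖(1 - toOp (groundProj h Λ)) v‖ ^ 2 ≤
      ∑ X ∈ Λ.powerset, ‖term h Λ X v‖ ^ 2 + ∑ X ∈ (A ∩ B).powerset, ‖term h Λ X v‖ ^ 2 := by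
  subst hΛ
  have hP : IsStarProjection (toOp (groundProj h (A ∪ B))) :=
    isStarProjection_toOp_iff.mpr (isStarProjection_groundProj h _)
  have h1 := quasi_factorization (P := projL h A B) (Q := projR h A B)
    (isStarProjection_embed_groundProj h _) (isStarProjection_embed_groundProj h _) hP
    (hh.embed_mul_toOp_groundProj hd _) (hh.embed_mul_toOp_groundProj hd _) v
  rw [← overlap_eq] at h1
  have h2 := hh.le_embed_of_le_gap hd (Finset.subset_union_left (s₂ := B)) hA v
  have h3 := hh.le_embed_of_le_gap hd (Finset.subset_union_right (s₁ := A)) hB v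
  have h4 := mul_le_mul_of_nonneg_left h1 hc
  -- `H_A + H_B` counts the terms inside `A ∩ B` twice and every other term of `A` or `B` once.
  have h5 : ∑ X ∈ A.powerset ∪ B.powerset, ‖term h (A ∪ B) X v‖ ^ 2 ≤
      ∑ X ∈ (A ∪ B).powerset, ‖term h (A ∪ B) X v‖ ^ 2 := by
    refine Finset.sum_le_sum_of_subset_of_nonneg ?_ fun _ _ _ => sq_nonneg _
    exact Finset.union_subset (Finset.powerset_mono.mpr Finset.subset_union_left)
      (Finset.powerset_mono.mpr Finset.subset_union_right)
  have h6 := Finset.sum_union_inter (s₁ := A.powerset) (s₂ := B.powerset)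
    (f := fun X => ‖term h (A ∪ B) X v‖ ^ 2)
  have h7 : A.powerset ∩ B.powerset = (A ∩ B).powerset := by
    ext X
    simp only [Finset.mem_inter, Finset.mem_powerset, Finset.subset_inter_iff]
  rw [h7] at h6
  simp only [projL, projR] at h4
  rw [mul_assoc]
  linarith

variable [MetricSpace Γ] {r : ℝ}

/-- `ℋ_∅` is one-dimensional, so an operator with eigenvalue `0` vanishes there. The empty set lies
in every power set and would otherwise be counted in all overlaps. -/
theorem IsFrustrationFree.apply_empty (hf : IsFrustrationFree r h) (hd : 0 < d) :
    h (∅ : Finset Γ) = 0 := by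
  have hp : IsStarProjection (toOp (h ∅)) :=
    isStarProjection_toOp_iff.mpr (hf.projection ∅)
  have hmem := groundEnergy_mem hd hp.isSelfAdjoint.isSymmetric
  rw [hf.energy_zero] at hmem
  obtain ⟨v, hv⟩ := Module.End.HasEigenvalue.exists_hasEigenvector hmem
  have h1 : toOp (h ∅) v = 0 := by
    have := hv.apply_eq_smul
    rw [Complex.ofReal_zero, zero_smul] at this
    exact this
  have hsub : Subsingleton (Config d (∅ : Finset Γ)) := ⟨fun σ τ => funext fun x => absurd x.2 (Finset.notMem_empty _)⟩
  ext σ τ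
  obtain rfl : σ = τ := Subsingleton.elim _ _
  have h2 : v σ ≠ 0 := by
    intro h0
    refine hv.2 ?_
    ext τ
    rw [Subsingleton.elim τ σ]
    exact h0
  have h3 : toOp (h ∅) v σ = h ∅ σ σ * v σ := by
    have e : toOp (h ∅) v σ = (h ∅).mulVec v.ofLp σ :=
      congrFun (Matrix.ofLp_toEuclideanCLM (h ∅) v) σ
    rw [e, Matrix.mulVec, dotProduct]
    exact Fintype.sum_subsingleton _ σ
  rw [h1] at h3
  have h4 : h ∅ σ σ * v σ = 0 := h3.symm
  simpa [h2] using h4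

theorem IsFrustrationFree.term_empty (hf : IsFrustrationFree r h) (hd : 0 < d) (Λ : Finset Γ) :
    term h Λ ∅ = 0 := by
  rw [term_of_subset h (Finset.empty_subset Λ), hf.apply_empty hd, map_zero]

theorem IsFrustrationFree.sum_overlaps_le (hf : IsFrustrationFree r h) (hd : 0 < d) {s : ℕ}
    {Λ : Finset Γ} {O : Fin s → Finset Γ} (hO : ∀ i, O i ⊆ Λ)
    (hdis : ∀ i j, i ≠ j → O i ∩ O j = ∅) (v : HilbertSpace d Λ) :
    ∑ i, ∑ X ∈ (O i).powerset, ‖term h Λ X v‖ ^ 2 ≤ ∑ X ∈ Λ.powerset, ‖term h Λ X v‖ ^ 2 := by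
  have h0 : ‖term h Λ ∅ v‖ ^ 2 = 0 := by rw [hf.term_empty hd]; simp
  have h1 : ∀ i, ∑ X ∈ (O i).powerset, ‖term h Λ X v‖ ^ 2
      = ∑ X ∈ (O i).powerset.erase ∅, ‖term h Λ X v‖ ^ 2 := fun i =>
    (Finset.sum_erase (f := fun X => ‖term h Λ X v‖ ^ 2) _ h0).symm
  rw [Finset.sum_congr rfl fun i _ => h1 i, ← Finset.sum_biUnion]
  · refine Finset.sum_le_sum_of_subset_of_nonneg ?_ fun _ _ _ => sq_nonneg _
    refine Finset.biUnion_subset.mpr fun i _ => (Finset.erase_subset _ _).trans ?_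
    exact Finset.powerset_mono.mpr (hO i)
  · intro i _ j _ hij
    refine Finset.disjoint_left.mpr fun X hX hX' => ?_
    rw [Finset.mem_erase, Finset.mem_powerset] at hX hX'
    refine hX.1 (Finset.subset_empty.mp ?_)
    rw [← hdis i j hij]
    exact Finset.subset_inter hX.2 hX'.2

/-- Summing the inequalities of the `s` decompositions gives `s c (1 - δ) (1 - P_Λ) ≤ (s + 1) H_Λ`,
because the overlaps are disjoint and together carry at most the energy of `Λ`. -/
theorem IsFrustrationFree.le_gap_of_decompositions (hf : IsFrustrationFree r h) (hd : 0 < d)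
    {s : ℕ} (hs : 0 < s) {Λ : Finset Γ} {A B : Fin s → Finset Γ} (hΛ : ∀ i, Λ = A i ∪ B i)
    (hdis : ∀ i j, i ≠ j → A i ∩ B i ∩ A j ∩ B j = ∅) {c δ : ℝ} (hc : 0 ≤ c)
    (hA : ∀ i, ENNReal.ofReal c ≤ gap h (A i)) (hB : ∀ i, ENNReal.ofReal c ≤ gap h (B i))
    (hδ : ∀ i, overlap h (A i) (B i) ≤ δ) :
    ENNReal.ofReal (c * ((1 - δ) / (1 + 1 / s))) ≤ gap h Λ := by
  have hh := hf.isAnnihilating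
  rw [hh.le_gap_iff hd]
  intro v
  set w := ‖(1 - toOp (groundProj h Λ)) v‖ ^ 2
  set E := ∑ X ∈ Λ.powerset, ‖term h Λ X v‖ ^ 2
  have hs' : (0 : ℝ) < s := by exact_mod_cast hs
  have h1 : ∀ i, c * (1 - δ) * w ≤ E + ∑ X ∈ (A i ∩ B i).powerset, ‖term h Λ X v‖ ^ 2 := fun i => by
    refine le_trans ?_ (hh.energy_ge_of_union hd (hΛ i) hc (hA i) (hB i) v)
    have := hδ i
    gcongr
  have h2 := Finset.sum_le_sum fun i (_ : i ∈ Finset.univ) => h1 i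
  rw [Finset.sum_add_distrib, Finset.sum_const, Finset.sum_const, Finset.card_univ,
    Fintype.card_fin, nsmul_eq_mul, nsmul_eq_mul] at h2
  have h3 := hf.sum_overlaps_le hd (Λ := Λ) (O := fun i => A i ∩ B i)
    (fun i => by rw [hΛ i]; exact Finset.inter_subset_left.trans Finset.subset_union_left)
    (fun i j hij => by rw [← Finset.inter_assoc]; exact hdis i j hij) v
  have h4 : s * (c * (1 - δ) * w) ≤ (s + 1) * E := by linarith
  have e : c * ((1 - δ) / (1 + 1 / s)) * w = s * (c * (1 - δ) * w) / (s + 1) := by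
    field_simp
  rw [e, div_le_iff₀ (by positivity)]
  linarith

/-- A region that splits into two non-interacting parts inherits their gap. -/
theorem IsFrustrationFree.le_gap_of_disjoint (hf : IsFrustrationFree r h) (hd : 0 < d)
    {Λ A B : Finset Γ} (hΛ : Λ = A ∪ B) (hAB : A ∩ B = ∅)
    (hdist : ∀ x ∈ Λ \ A, ∀ y ∈ Λ \ B, r < dist x y) {c : ℝ} (hc : 0 ≤ c)
    (hA : ENNReal.ofReal c ≤ gap h A) (hB : ENNReal.ofReal c ≤ gap h B) :
    ENNReal.ofReal c ≤ gap h Λ := by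
  have hh := hf.isAnnihilating
  rw [hh.le_gap_iff hd]
  intro v
  have h1 := hh.energy_ge_of_union hd hΛ hc hA hB v
  have h2 : overlap h A B = 0 := by
    refine hh.overlap_eq_zero_of_disjoint hd (Finset.disjoint_iff_inter_eq_empty.mpr hAB) ?_
    intro X hX hXA hXB
    by_contra h0
    obtain ⟨x, hx, hxA⟩ := Finset.not_subset.mp hXA
    obtain ⟨y, hy, hyB⟩ := Finset.not_subset.mp hXB
    have := hdist x (Finset.mem_sdiff.mpr ⟨hΛ ▸ hX hx, hxA⟩) y
      (Finset.mem_sdiff.mpr ⟨hΛ ▸ hX hy, hyB⟩)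
    exact absurd (hf.dist_le h0 hx hy) (not_le.mpr this)
  rw [h2, hAB, Finset.powerset_empty, Finset.sum_singleton, hf.term_empty hd] at h1
  simpa using h1

end Recursion

/-! ### Length scales, boxes and the construction of decompositions -/

section Regions

open scoped Classical

theorem len_eq_pow (D k : ℕ) : len D k = ((3 / 2 : ℝ) ^ (1 / (D : ℝ))) ^ k := by
  rw [len, ← Real.rpow_natCast, ← Real.rpow_mul (by norm_num)]
  congr 1
  ring

theorem one_lt_len_base {D : ℕ} (hD : 0 < D) : 1 < (3 / 2 : ℝ) ^ (1 / (D : ℝ)) :=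
  Real.one_lt_rpow (by norm_num) (by positivity)

theorem len_pos (D k : ℕ) : 0 < len D k := Real.rpow_pos_of_pos (by norm_num) _

theorem len_mono (D : ℕ) : Monotone (len D) := fun a b hab => by
  refine Real.rpow_le_rpow_of_exponent_le (by norm_num) ?_
  have : (a : ℝ) ≤ b := by exact_mod_cast hab
  gcongr

theorem tendsto_len {D : ℕ} (hD : 0 < D) : Filter.Tendsto (len D) Filter.atTop Filter.atTop := by
  have := tendsto_pow_atTop_atTop_of_one_lt (one_lt_len_base hD)
  exact this.congr fun k => (len_eq_pow D k).symm

theorem len_add_self {D : ℕ} (hD : 0 < D) (k : ℕ) : len D (k + D) = 3 / 2 * len D k := by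
  have : (D : ℝ) ≠ 0 := by positivity
  rw [len, len, Nat.cast_add, add_div, div_self this, Real.rpow_add (by norm_num), Real.rpow_one,
    mul_comm]

variable {Γ : Type*} {D : ℕ} {p : ℝ≥0∞} {d : ℕ} {h : Interaction Γ d} {r : ℝ}

theorem regionClass_mono (ι : Γ → PiLp p (fun _ : Fin D => ℝ)) : Monotone (regionClass ι) := by
  rintro a b hab Λ ⟨v, π, H⟩
  refine ⟨v, π, fun x hx i => ⟨(H x hx i).1, (H x hx i).2.trans ?_⟩⟩
  have := len_mono D (Nat.add_le_add_right hab ((π i : ℕ) + 1))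
  linarith

theorem le_gapInf_iff {ι : Γ → PiLp p (fun _ : Fin D => ℝ)} {k : ℕ} {c : ℝ≥0∞} :
    c ≤ gapInf ι h k ↔ ∀ Λ ∈ regionClass ι k, c ≤ gap h Λ := le_iInf₂_iff

/-- Every region of `F_{k+1}` is covered by a slab of width `3 l_{k+1} / 2` in some direction such
that its parts in subslabs of width `l_{k+1}` are in `F_k`. -/
theorem exists_direction (hD : 0 < D) {ι : Γ → PiLp p (fun _ : Fin D => ℝ)} {k : ℕ}
    {Λ : Finset Γ} (hΛ : Λ ∈ regionClass ι (k + 1)) :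
    ∃ (i₀ : Fin D) (a : ℝ), (∀ x ∈ Λ, a ≤ ι x i₀ ∧ ι x i₀ ≤ a + 3 / 2 * len D (k + 1)) ∧
      ∀ (Λ' : Finset Γ) (b : ℝ), Λ' ⊆ Λ →
        (∀ x ∈ Λ', b ≤ ι x i₀ ∧ ι x i₀ ≤ b + len D (k + 1)) → Λ' ∈ regionClass ι k := by
  obtain ⟨n, rfl⟩ : ∃ n, D = n + 1 := ⟨D - 1, by omega⟩
  obtain ⟨v, π, H⟩ := hΛ
  -- The longest side is `l_{k+1+D} = 3/2 l_{k+1}`. Shortened to `l_{k+1}` it becomes the shortest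
  -- side at level `k`, and the rotation moves each other side up by one index.
  refine ⟨π.symm (Fin.last n), v (π.symm (Fin.last n)), fun x hx => ?_, fun Λ' b hs hb => ?_⟩
  · have h1 := H x hx (π.symm (Fin.last n))
    rw [Equiv.apply_symm_apply, Fin.val_last, len_add_self hD] at h1
    exact h1
  · refine ⟨Function.update v (π.symm (Fin.last n)) b, π.trans (finRotate (n + 1)),
      fun x hx i => ?_⟩
    by_cases hi : i = π.symm (Fin.last n)
    · subst hi
      rw [Function.update_self, Equiv.trans_apply, Equiv.apply_symm_apply, finRotate_last]
      simpa using hb x hx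
    · rw [Function.update_of_ne hi]
      have hne : π i ≠ Fin.last n := fun e => hi (by rw [← e, Equiv.symm_apply_apply])
      have h1 := H x (hs hx) i
      rw [Equiv.trans_apply, coe_finRotate_of_ne_last hne]
      have e : k + ((π i : ℕ) + 1 + 1) = k + 1 + ((π i : ℕ) + 1) := by ring
      rw [e]
      exact h1

variable [Fact (1 ≤ p)]

theorem exists_mem_regionClass (hD : 0 < D) (ι : Γ → PiLp p (fun _ : Fin D => ℝ)) (Λ : Finset Γ) :
    ∃ k, Λ ∈ regionClass ι k := by
  obtain ⟨R, hR⟩ : ∃ R : ℝ, ∀ x ∈ Λ, ‖ι x‖ ≤ R :=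
    ⟨∑ x ∈ Λ, ‖ι x‖, fun x hx => Finset.single_le_sum (f := fun x => ‖ι x‖)
      (fun _ _ => norm_nonneg _) hx⟩
  obtain ⟨k, hk⟩ := ((tendsto_len hD).eventually_ge_atTop (2 * R)).exists
  refine ⟨k, fun _ => -R, Equiv.refl _, fun x hx i => ?_⟩
  have h1 := abs_le.mp ((PiLp.norm_apply_le (ι x) i).trans (hR x hx))
  have h2 := len_mono D (Nat.le_add_right k (((Equiv.refl (Fin D)) i : ℕ) + 1))
  constructor
  · exact h1.1
  · linarith [h1.2]

variable [MetricSpace Γ]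

/-- Existence of decompositions, unless the region splits into two distant parts. -/
theorem exists_decomposition (hD : 0 < D) {ι : Γ → PiLp p (fun _ : Fin D => ℝ)} (hι : Isometry ι)
    {k s : ℕ} (hs : 0 < s) {Λ : Finset Γ} (hΛ : Λ ∈ regionClass ι (k + 1) \ regionClass ι k) :
    (∃ A B : Fin s → Finset Γ, IsDecomposition ι (k + 1) s Λ A B) ∨
    ∃ A B : Finset Γ, Λ = A ∪ B ∧ A ∩ B = ∅ ∧ A ∈ regionClass ι k ∧ B ∈ regionClass ι k ∧
      ∀ x ∈ Λ \ A, ∀ y ∈ Λ \ B, len D (k + 1) / (2 * s) ≤ dist x y := by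
  obtain ⟨i₀, a, ha, hsub⟩ := exists_direction hD hΛ.1
  set L := len D (k + 1) with hL
  have hL0 : 0 < L := len_pos _ _
  have hs' : (0 : ℝ) < s := by exact_mod_cast hs
  -- The middle part of the slab, from `a + L/2` to `a + L`, is cut into `s` strips of width `ε`.
  -- The `j`-th overlap is the `j`-th strip, and both pieces have width at most `L`.
  let ε : ℝ := L / (2 * s)
  have hε : 0 < ε := by positivity
  have hsε : s * ε = L / 2 := by simp only [ε]; field_simp
  let b : ℕ → ℝ := fun j => a + L / 2 + j * ε
  have hbs : ∀ j : ℕ, b (j + 1) = b j + ε := fun j => by simp only [b]; push_cast; ring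
  have hbm : Monotone b := monotone_nat_of_le_succ fun j => by rw [hbs]; linarith
  let A : Fin s → Finset Γ := fun j => Λ.filter fun x => ι x i₀ < b (j + 1)
  let B : Fin s → Finset Γ := fun j => Λ.filter fun x => b j ≤ ι x i₀
  have hmA : ∀ {j x}, x ∈ A j ↔ x ∈ Λ ∧ ι x i₀ < b (j + 1) := Finset.mem_filter
  have hmB : ∀ {j x}, x ∈ B j ↔ x ∈ Λ ∧ b j ≤ ι x i₀ := Finset.mem_filter
  have hun : ∀ j, Λ = A j ∪ B j := fun j => by
    ext x
    rw [Finset.mem_union, hmA, hmB]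
    constructor
    · intro hx
      rcases lt_or_ge (ι x i₀) (b (j + 1)) with hlt | hge
      · exact Or.inl ⟨hx, hlt⟩
      · exact Or.inr ⟨hx, (hbm (Nat.le_succ _)).trans hge⟩
    · rintro (hx | hx) <;> exact hx.1
  have hAk : ∀ j, A j ∈ regionClass ι k := fun j => by
    refine hsub _ a (Finset.filter_subset _ _) fun x hx => ?_
    rw [hmA] at hx
    refine ⟨(ha x hx.1).1, hx.2.le.trans ?_⟩
    have h1 : b (j + 1) ≤ b s := hbm j.2
    have h2 : b s = a + L / 2 + L / 2 := by simp only [b]; rw [hsε]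
    linarith
  have hBk : ∀ j, B j ∈ regionClass ι k := fun j => by
    refine hsub _ (a + L / 2) (Finset.filter_subset _ _) fun x hx => ?_
    rw [hmB] at hx
    have h1 : b 0 ≤ b j := hbm (Nat.zero_le _)
    have h2 : b 0 = a + L / 2 := by simp [b]
    exact ⟨by linarith, by linarith [(ha x hx.1).2]⟩
  have hd : ∀ j, ∀ x ∈ Λ \ A j, ∀ y ∈ Λ \ B j, L / (2 * s) ≤ dist x y := by
    intro j x hx y hy
    rw [Finset.mem_sdiff, hmA] at hx
    rw [Finset.mem_sdiff, hmB] at hy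
    have h1 : b (j + 1) ≤ ι x i₀ := by
      by_contra hlt
      exact hx.2 ⟨hx.1, not_le.mp hlt⟩
    have h2 : ι y i₀ < b j := by
      by_contra hlt
      exact hy.2 ⟨hy.1, not_lt.mp hlt⟩
    have h3 := PiLp.norm_apply_le (ι x - ι y) i₀
    rw [← dist_eq_norm, hι.dist_eq, PiLp.sub_apply, Real.norm_eq_abs] at h3
    have h4 := le_abs_self (ι x i₀ - ι y i₀)
    have h5 := hbs j
    simp only [ε] at h5
    linarith
  by_cases hne : ∀ j, (A j ∩ B j).Nonempty
  · left
    have hdis : ∀ i j : Fin s, i < j → ∀ x, x ∈ A i → x ∈ B j → False := by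
      intro i j hij x hx hy
      rw [hmA] at hx
      rw [hmB] at hy
      have : b (i + 1) ≤ b j := hbm hij
      linarith [hx.2, hy.2]
    have hdis' : ∀ i j, i ≠ j → A i ∩ B i ∩ A j ∩ B j = ∅ := by
      intro i j hij
      refine Finset.eq_empty_of_forall_notMem fun x hx => ?_
      simp only [Finset.mem_inter] at hx
      rcases lt_or_gt_of_ne hij with hlt | hgt
      · exact hdis i j hlt x hx.1.1.1 hx.2
      · exact hdis j i hgt x hx.1.2 hx.1.1.2
    refine ⟨A, B, ?_, ?_, ?_, hun, hAk, hBk, ?_, hdis'⟩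
    · intro i j hij
      by_contra hne'
      have hAe : A i = A j := congrArg Prod.fst hij
      have hBe : B i = B j := congrArg Prod.snd hij
      obtain ⟨x, hx⟩ := hne i
      have hx' := Finset.mem_inter.mp hx
      -- Equal pairs would share their nonempty overlap, against disjointness. This is why an empty
      -- strip is treated as a separate case.
      have : x ∈ A i ∩ B i ∩ A j ∩ B j := by
        simp only [Finset.mem_inter]
        exact ⟨⟨hx', hAe ▸ hx'.1⟩, hBe ▸ hx'.2⟩
      rw [hdis' i j hne'] at this
      exact absurd this (Finset.notMem_empty x)
    · exact fun i => (hne i).mono Finset.inter_subset_left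
    · exact fun i => (hne i).mono Finset.inter_subset_right
    · intro i
      refine le_iInf₂ fun x hx => le_iInf₂ fun y hy => ?_
      rw [edist_dist]
      refine ENNReal.ofReal_le_ofReal (le_trans ?_ (hd i x hx y hy))
      have : L / (8 * s) ≤ L / (2 * s) := by gcongr; norm_num
      linarith
  · right
    push Not at hne
    obtain ⟨j, hj⟩ := hne
    exact ⟨A j, B j, hun j, hj, hAk j, hBk j, hd j⟩

/-- One step of the recursion for the infimum of the gaps over `F_k`. -/
theorem IsFrustrationFree.le_gapInf_succ (hf : IsFrustrationFree r h) (hD : 0 < D) (hd : 0 < d)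
    {ι : Γ → PiLp p (fun _ : Fin D => ℝ)} (hι : Isometry ι) {k s : ℕ} (hs : 0 < s)
    (hr : r < len D (k + 1) / (2 * s)) {c δ : ℝ} (hc : 0 ≤ c) (hδ0 : 0 ≤ δ)
    (hδ : deltaSup ι h (k + 1) s ≤ ENNReal.ofReal δ) (hgap : ENNReal.ofReal c ≤ gapInf ι h k) :
    ENNReal.ofReal (c * ((1 - δ) / (1 + 1 / s))) ≤ gapInf ι h (k + 1) := by
  rw [le_gapInf_iff] at hgap ⊢
  intro Λ hΛ
  have hle : c * ((1 - δ) / (1 + 1 / s)) ≤ c := by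
    refine mul_le_of_le_one_right hc ?_
    rw [div_le_one (by positivity)]
    have : (0 : ℝ) ≤ 1 / s := by positivity
    linarith
  by_cases hΛk : Λ ∈ regionClass ι k
  · exact (ENNReal.ofReal_le_ofReal hle).trans (hgap Λ hΛk)
  · rcases exists_decomposition hD hι hs ⟨hΛ, hΛk⟩ with ⟨A, B, hdec⟩ | ⟨A, B, h1, h2, h3, h4, h5⟩
    · refine hf.le_gap_of_decompositions hd hs hdec.union_eq hdec.overlap_disjoint hc
        (fun i => hgap _ (hdec.mem_left i)) (fun i => hgap _ (hdec.mem_right i)) fun i => ?_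
      refine (ENNReal.ofReal_le_ofReal_iff hδ0).mp (le_trans ?_ hδ)
      exact le_iSup₂_of_le Λ ⟨hΛ, hΛk⟩ (le_iSup₂_of_le A B (le_iSup₂_of_le hdec i le_rfl))
    · refine (ENNReal.ofReal_le_ofReal hle).trans ?_
      exact hf.le_gap_of_disjoint hd h1 h2 (fun x hx y hy => hr.trans_le (h5 x hx y hy)) hc
        (hgap _ h3) (hgap _ h4)

/-- Balls of a fixed radius contain a bounded number of sites. -/
theorem exists_card_le {ι : Γ → PiLp p (fun _ : Fin D => ℝ)} (hι : Isometry ι)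
    (hsep : ∀ x y : Γ, x ≠ y → 1 ≤ dist x y) (R : ℝ) :
    ∃ N : ℕ, ∀ (x : Γ) (S : Finset Γ), (∀ y ∈ S, dist y x ≤ R) → S.card ≤ N := by
  have : ProperSpace (PiLp p (fun _ : Fin D => ℝ)) := FiniteDimensional.proper_real _
  obtain ⟨t, ht, hcov⟩ := Metric.totallyBounded_iff.mp
    (isCompact_closedBall (0 : PiLp p (fun _ : Fin D => ℝ)) R).totallyBounded (1 / 2) (by norm_num)
  refine ⟨ht.toFinset.card, fun x S hS => ?_⟩
  have hc : ∀ y ∈ S, ∃ z ∈ t, dist (ι y - ι x) z < 1 / 2 := fun y hy => by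
    have hm : ι y - ι x ∈ Metric.closedBall (0 : PiLp p (fun _ : Fin D => ℝ)) R := by
      rw [mem_closedBall_zero_iff, ← dist_eq_norm, hι.dist_eq]
      exact hS y hy
    simpa using hcov hm
  -- Sites sent to the same point of the `1/2`-net would be closer than `1`, hence equal.
  choose! z hz hdist using hc
  refine Finset.card_le_card_of_injOn z (fun y hy => ht.mem_toFinset.mpr (hz y hy)) ?_
  intro y hy y' hy' he
  by_contra hne
  have h1 := hsep y y' hne
  have h2 := hdist y hy
  have h3 := hdist y' hy'
  rw [← he] at h3
  have h4 := dist_triangle_right (ι y - ι x) (ι y' - ι x) (z y)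
  rw [dist_sub_right, hι.dist_eq] at h4
  linarith

end Regions

/-! ### Relations between the decay conditions and the uniform gap -/

section Conditions

open scoped Classical
open Filter Topology

variable {Γ : Type*} [MetricSpace Γ] {D : ℕ} {p : ℝ≥0∞} {d : ℕ} {h : Interaction Γ d} {r : ℝ}

theorem rpow_le_div {α l : ℝ} (h0 : 0 < α) (h1 : α < 1) (hl : 0 < l) :
    α ^ l ≤ (-Real.log α)⁻¹ * l ^ (-1 : ℝ) := by
  have hlog : 0 < -Real.log α := neg_pos.mpr (Real.log_neg h0 h1)
  rw [Real.rpow_neg_one, ← mul_inv, Real.rpow_def_of_pos h0]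
  have h2 : Real.exp (Real.log α * l) = (Real.exp (-Real.log α * l))⁻¹ := by
    rw [← Real.exp_neg]; congr 1; ring
  rw [h2]
  refine inv_anti₀ (by positivity) ?_
  linarith [Real.add_one_le_exp (-Real.log α * l)]

theorem ConditionA.exists_le_inv {f : ℝ → ℝ} (hA : ConditionA r h f) :
    ∃ C : ℝ, 0 < C ∧ ∀ l, 0 < l → f l ≤ C * l ^ (-1 : ℝ) := by
  obtain ⟨-, ⟨c, α, hc, h0, h1, H⟩, -⟩ := hA
  have hlog : 0 < -Real.log α := neg_pos.mpr (Real.log_neg h0 h1)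
  refine ⟨c * (-Real.log α)⁻¹, by positivity, fun l hl => (H l hl).trans ?_⟩
  rw [mul_assoc]
  exact mul_le_mul_of_nonneg_left (rpow_le_div h0 h1 hl) hc.le

theorem ConditionA.conditionB {f : ℝ → ℝ} (hA : ConditionA r h f) : ConditionB r h f := by
  obtain ⟨C, hC, H⟩ := hA.exists_le_inv
  exact ⟨hA.1, ⟨C, 1, hC, one_pos, H⟩, hA.2.2⟩

theorem empty_of_regionDist_eq_top {S T : Finset Γ} (hST : regionDist S T = ∞) :
    S = ∅ ∨ T = ∅ := by
  by_contra hcon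
  push Not at hcon
  obtain ⟨⟨x, hx⟩, ⟨y, hy⟩⟩ := hcon
  have := edist_ge_regionDist hx hy
  rw [hST, top_le_iff] at this
  exact edist_ne_top x y this

/-- The decay function need not be monotone, so the comparison passes through its power bound. An
infinite overlap size means that one region contains the other, and then the overlap vanishes. -/
theorem overlap_le_of_dist_ge {f : ℝ → ℝ} (hB : OverlapBound r h f) {C α : ℝ} (hC : 0 ≤ C)
    (hα : 0 ≤ α) (hf : ∀ l, 0 < l → f l ≤ C * l ^ (-α)) {A B : Finset Γ} {u : ℝ} (hu0 : 0 < u)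
    (hu : r < u) (hAB : ENNReal.ofReal u ≤ overlapSize A B) :
    overlap h A B ≤ C * u ^ (-α) := by
  by_cases htop : overlapSize A B = ∞
  · have : overlap h A B = 0 := by
      refine overlap_eq_zero_of_subset h ?_
      rcases empty_of_regionDist_eq_top htop with e | e
      · exact Or.inl (Finset.union_eq_left.mpr
          ((Finset.subset_union_right).trans (Finset.sdiff_eq_empty_iff_subset.mp e)))
      · exact Or.inr (Finset.union_eq_right.mpr
          ((Finset.subset_union_left).trans (Finset.sdiff_eq_empty_iff_subset.mp e)))
    rw [this]; positivity
  · set l := (overlapSize A B).toReal with hl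
    have he : overlapSize A B = ENNReal.ofReal l := (ENNReal.ofReal_toReal htop).symm
    have hul : u ≤ l := (ENNReal.ofReal_le_iff_le_toReal htop).mp hAB
    refine (hB A B l (hu.trans_le hul) he).trans ((hf l (hu0.trans_le hul)).trans ?_)
    refine mul_le_mul_of_nonneg_left ?_ hC
    exact Real.rpow_le_rpow_of_nonpos hu0 hul (neg_nonpos.mpr hα)

theorem deltaSup_le {ι : Γ → PiLp p (fun _ : Fin D => ℝ)} {k s : ℕ} {δ : ℝ}
    (H : ∀ A B : Finset Γ, ENNReal.ofReal (len D k / (8 * s) - 2) ≤ overlapSize A B →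
      overlap h A B ≤ δ) : deltaSup ι h k s ≤ ENNReal.ofReal δ := by
  refine iSup₂_le fun Λ _ => iSup₂_le fun A B => iSup₂_le fun hdec i => ?_
  refine ENNReal.ofReal_le_ofReal (H _ _ ?_)
  rw [overlapSize, ← hdec.union_eq i]
  exact hdec.dist_ge i

theorem IsAdmissible.tendsto {s : ℕ → ℕ} (hs : IsAdmissible D s) :
    Tendsto (fun k => (s k : ℝ) / len D k) atTop (𝓝 0) := hs.summable_div.tendsto_atTop_zero

theorem tsum_lt_top_of_eventually_le {f : ℕ → ℝ≥0∞} {b : ℕ → ℝ} (hb : Summable b)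
    (hb0 : ∀ k, 0 ≤ b k) {C : ℝ} (hfC : ∀ k, f k ≤ ENNReal.ofReal C)
    (hfb : ∀ᶠ k in atTop, f k ≤ ENNReal.ofReal (b k)) : ∑' k, f k < ∞ := by
  obtain ⟨K, hK⟩ := eventually_atTop.mp hfb
  have hsum : Summable fun k => b k + if k ∈ Finset.range K then C else 0 :=
    hb.add (summable_of_ne_finset_zero (s := Finset.range K) fun k hk => if_neg hk)
  refine lt_of_le_of_lt (ENNReal.tsum_le_tsum fun k => ?_) (lt_top_iff_ne_top.mpr hsum.tsum_ofReal_ne_top)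
  by_cases hk : k ∈ Finset.range K
  · rw [if_pos hk]
    exact (hfC k).trans (ENNReal.ofReal_le_ofReal (by linarith [hb0 k]))
  · rw [if_neg hk, add_zero]
    exact hK k (by simpa using hk)

/-- Polynomial decay of the overlap gives Condition C if `∑ (s_k / l_k) ^ α < ∞`. -/
theorem IsFrustrationFree.conditionC (hf : IsFrustrationFree r h) (hr : 0 < r) (hd : 0 < d)
    (ι : Γ → PiLp p (fun _ : Fin D => ℝ)) {f : ℝ → ℝ} (hB : OverlapBound r h f) {C α : ℝ}
    (hC : 0 ≤ C) (hα : 0 ≤ α) (hfl : ∀ l, 0 < l → f l ≤ C * l ^ (-α)) {s : ℕ → ℕ}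
    (hs : IsAdmissible D s) (hsum : Summable fun k => ((s k : ℝ) / len D k) ^ α) :
    ConditionC ι h s := by
  have hpos : ∀ k, 0 < (s k : ℝ) / len D k := fun k =>
    div_pos (by exact_mod_cast hs.pos k) (len_pos D k)
  have hsum' : Summable fun k => C * (16 ^ α * ((s (k + 1) : ℝ) / len D (k + 1)) ^ α) :=
    (((summable_nat_add_iff 1).mpr hsum).mul_left _).mul_left _
  refine tsum_lt_top_of_eventually_le hsum'
    (fun k => mul_nonneg hC (mul_nonneg (by positivity) (Real.rpow_nonneg (hpos _).le _)))
    (C := 2) (fun k => ?_) ?_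
  · exact deltaSup_le fun A B _ => hf.isAnnihilating.overlap_le_two hd A B
  · have h1 := (tendsto_add_atTop_iff_nat 1).mpr hs.tendsto
    -- With `x = s/l`, the first bound gives `1/(8x) - 2 ≥ 1/(16x)` and the second makes `1/(16x)`
    -- exceed the range `r`.
    have hx : 0 < min (1 / 32) (1 / (16 * (r + 1))) := by positivity
    filter_upwards [h1.eventually_lt_const hx] with k hk
    have hk1 := hk.trans_le (min_le_left _ _)
    have hk2 := hk.trans_le (min_le_right _ _)
    set x := (s (k + 1) : ℝ) / len D (k + 1) with hxdef
    have hx0 : 0 < x := hpos _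
    have hu : len D (k + 1) / (8 * s (k + 1)) - 2 = 1 / (8 * x) - 2 := by
      have := len_pos D (k + 1)
      have : (0 : ℝ) < s (k + 1) := by exact_mod_cast hs.pos _
      rw [hxdef]; field_simp
    have h2 : 1 / (16 * x) ≤ 1 / (8 * x) - 2 := by
      have : 1 / (8 * x) = 1 / (16 * x) + 1 / (16 * x) := by field_simp; norm_num
      have : 2 ≤ 1 / (16 * x) := by
        rw [le_div_iff₀ (by positivity)]; linarith
      linarith
    have h3 : r < 1 / (16 * x) := by
      rw [lt_div_iff₀ (by positivity)] at hk2 ⊢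
      nlinarith
    refine deltaSup_le fun A B hAB => ?_
    rw [hu] at hAB
    refine (overlap_le_of_dist_ge hB hC hα hfl (u := 1 / (16 * x)) (by positivity) h3
      ((ENNReal.ofReal_le_ofReal h2).trans hAB)).trans_eq ?_
    rw [one_div, Real.inv_rpow (by positivity), Real.rpow_neg (by positivity), inv_inv,
      Real.mul_rpow (by norm_num) hx0.le]

theorem summable_succ_pow_mul_geometric (m : ℕ) {ρ : ℝ} (h0 : 0 < ρ) (h1 : ρ < 1) :
    Summable fun k : ℕ => ((k : ℝ) + 1) ^ m * ρ ^ k := by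
  have := summable_pow_mul_geometric_of_norm_lt_one m (r := ρ)
    (by rwa [Real.norm_of_nonneg h0.le])
  have h2 := (((summable_nat_add_iff 1).mpr this).mul_left ρ⁻¹)
  refine h2.congr fun k => ?_
  push_cast
  rw [pow_succ]
  field_simp

/-- Geometric growth of `len` beats the polynomial numerator for every exponent `α > 0`, however
small. -/
theorem summable_sq_div_len_rpow (hD : 0 < D) {α : ℝ} (hα : 0 < α) :
    Summable fun k => ((((k + 1) ^ 2 : ℕ) : ℝ) / len D k) ^ α := by
  set q := (3 / 2 : ℝ) ^ (1 / (D : ℝ)) with hq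
  have hq1 : 1 < q := one_lt_len_base hD
  have hq0 : 0 < q := by linarith
  have hρ0 : 0 < (q ^ α)⁻¹ := by positivity
  have hρ1 : (q ^ α)⁻¹ < 1 := inv_lt_one_of_one_lt₀ (Real.one_lt_rpow hq1 hα)
  refine Summable.of_nonneg_of_le (fun k => ?_) (fun k => ?_)
    (summable_succ_pow_mul_geometric ⌈2 * α⌉₊ hρ0 hρ1)
  · have := len_pos D k
    positivity
  · rw [Real.div_rpow (by positivity) (len_pos D k).le, len_eq_pow, ← hq, div_eq_mul_inv, inv_pow,
      ← Real.rpow_natCast q k, ← Real.rpow_mul hq0.le, mul_comm (k : ℝ) α, Real.rpow_mul hq0.le,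
      Real.rpow_natCast]
    refine mul_le_mul_of_nonneg_right ?_ (by positivity)
    push_cast
    rw [← Real.rpow_natCast _ 2, ← Real.rpow_mul (by positivity), ← Real.rpow_natCast]
    exact Real.rpow_le_rpow_of_exponent_le (by linarith [(Nat.cast_nonneg k : (0 : ℝ) ≤ k)])
      (by simpa using Nat.le_ceil (2 * α))

theorem isAdmissible_sq (hD : 0 < D) : IsAdmissible D fun k => (k + 1) ^ 2 where
  pos k := by positivity
  increasing a b hab := Nat.pow_le_pow_left (Nat.add_le_add_right hab 1) 2
  summable_inv := by
    have := (summable_nat_add_iff 1).mpr (Real.summable_one_div_nat_pow.mpr one_lt_two)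
    exact this.congr fun k => by push_cast; rfl
  summable_div := by
    simpa only [Real.rpow_one] using summable_sq_div_len_rpow hD one_pos

/-- Turns the product of the losses per scale into the exponential of a convergent sum, by `exp
(-2δ) ≤ 1 - δ` and `exp (-x) ≤ 1 / (1 + x)`. -/
theorem exp_neg_le_factor {δ x : ℝ} (h0 : 0 ≤ δ) (h1 : δ ≤ 1 / 2) (hx : 0 ≤ x) :
    Real.exp (-(2 * δ + x)) ≤ (1 - δ) / (1 + x) := by
  rw [neg_add, Real.exp_add, div_eq_mul_inv]
  have h2 : Real.exp (-(2 * δ)) ≤ 1 - δ := by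
    rw [Real.exp_neg]
    refine inv_le_of_inv_le₀ (by linarith) ?_
    refine le_trans ?_ (Real.add_one_le_exp (2 * δ))
    rw [inv_le_iff_one_le_mul₀ (by linarith)]
    nlinarith
  have h3 : Real.exp (-x) ≤ (1 + x)⁻¹ := by
    rw [Real.exp_neg]
    exact inv_anti₀ (by linarith) (by linarith [Real.add_one_le_exp x])
  exact mul_le_mul h2 h3 (Real.exp_pos _).le (by linarith)

/-- Condition C for one admissible sequence gives a uniform lower bound on the gaps. -/
theorem IsFrustrationFree.exists_le_iInf_gapInf [Fact (1 ≤ p)] (hf : IsFrustrationFree r h)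
    (hr : 0 < r) (hD : 0 < D) (hd : 0 < d) {ι : Γ → PiLp p (fun _ : Fin D => ℝ)}
    (hι : Isometry ι) (hpos : ∀ k, 0 < gapInf ι h k) {s : ℕ → ℕ} (hs : IsAdmissible D s)
    (hC : ConditionC ι h s) : ∃ lam : ℝ, 0 < lam ∧ ENNReal.ofReal lam ≤ ⨅ k, gapInf ι h k := by
  have hne : ∑' k, deltaSup ι h (k + 1) (s (k + 1)) ≠ ∞ := hC.ne
  let δ : ℕ → ℝ := fun k => (deltaSup ι h (k + 1) (s (k + 1))).toReal
  have hδ0 : ∀ k, 0 ≤ δ k := fun k => ENNReal.toReal_nonneg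
  have hδ : ∀ k, deltaSup ι h (k + 1) (s (k + 1)) = ENNReal.ofReal (δ k) := fun k =>
    (ENNReal.ofReal_toReal (ENNReal.ne_top_of_tsum_ne_top hne k)).symm
  have hδs : Summable δ := ENNReal.summable_toReal hne
  let a : ℕ → ℝ := fun k => 2 * δ k + 1 / s (k + 1)
  have ha0 : ∀ k, 0 ≤ a k := fun k => by have := hδ0 k; positivity
  have has : Summable a := (hδs.mul_left 2).add ((summable_nat_add_iff 1).mpr hs.summable_inv)
  have e1 : ∀ᶠ k in atTop, δ k < 1 / 2 :=
    hδs.tendsto_atTop_zero.eventually_lt_const (by norm_num)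
  have e2 : ∀ᶠ k in atTop, (s (k + 1) : ℝ) / len D (k + 1) < 1 / (2 * r) :=
    ((tendsto_add_atTop_iff_nat 1).mpr hs.tendsto).eventually_lt_const (by positivity)
  -- From scale `K` on, `δ k < 1/2` and the strips are wider than `r`. The recursion starts there,
  -- from a real `μ` below the possibly infinite gap; smaller scales follow by monotonicity of the
  -- classes.
  obtain ⟨K, hK⟩ := eventually_atTop.mp (e1.and e2)
  obtain ⟨μ, -, hμ0, hμ⟩ := ENNReal.lt_iff_exists_real_btwn.mp (hpos K)
  have hμpos : 0 < μ := ENNReal.ofReal_pos.mp hμ0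
  have main : ∀ n, ENNReal.ofReal (μ * Real.exp (-∑ j ∈ Finset.range n, a (K + j)))
      ≤ gapInf ι h (K + n) := by
    intro n
    induction n with
    | zero => simpa using hμ.le
    | succ n ih =>
      obtain ⟨h1, h2⟩ := hK (K + n) (Nat.le_add_right _ _)
      have hsp : (0 : ℝ) < s (K + n + 1) := by exact_mod_cast hs.pos _
      have hlen := len_pos D (K + n + 1)
      have hrl : r < len D (K + n + 1) / (2 * s (K + n + 1)) := by
        rw [div_lt_div_iff₀ hlen (by positivity)] at h2
        rw [lt_div_iff₀ (by positivity)]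
        linarith
      have h3 := hf.le_gapInf_succ hD hd hι (hs.pos _) hrl (by positivity) (hδ0 _) (hδ _).le ih
      refine (ENNReal.ofReal_le_ofReal ?_).trans h3
      rw [Finset.sum_range_succ, neg_add, Real.exp_add, ← mul_assoc]
      exact mul_le_mul_of_nonneg_left (exp_neg_le_factor (hδ0 _) h1.le (by positivity))
        (by positivity)
  have hKs : Summable fun j => a (K + j) := by
    simpa only [add_comm] using (summable_nat_add_iff K).mpr has
  refine ⟨μ * Real.exp (-∑' j, a (K + j)), by positivity, le_iInf fun k => ?_⟩
  have h4 : gapInf ι h (K + k) ≤ gapInf ι h k :=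
    le_gapInf_iff.mpr fun Λ hΛ =>
      le_gapInf_iff.mp le_rfl Λ (regionClass_mono ι (Nat.le_add_left k K) hΛ)
  refine le_trans (ENNReal.ofReal_le_ofReal ?_) ((main k).trans h4)
  refine mul_le_mul_of_nonneg_left (Real.exp_le_exp.mpr (neg_le_neg ?_)) hμpos.le
  exact hKs.sum_le_tsum _ fun j _ => ha0 _

end Conditions

end SpinLattice

end

/-! ### The main theorem -/

open SpinLattice
theorem mainTheorem1 {D : ℕ} (hD : 0 < D) {p : ℝ≥0∞} [Fact (1 ≤ p)]
    {Γ : Type*} [MetricSpace Γ] (hsep : ∀ x y : Γ, x ≠ y → 1 ≤ dist x y)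
    (ι : Γ → PiLp p (fun _ : Fin D => ℝ)) (hι : Isometry ι) (r : ℝ) (hr : 0 < r) :
    ∃ g : ℝ, 0 < g ∧ ∀ (d : ℕ) (_ : 0 < d) (h : Interaction Γ d), IsFrustrationFree r h →
      (∀ lam : ℝ, 0 < lam → ENNReal.ofReal lam ≤ ⨅ k, gapInf ι h k →
        ConditionA r h (fun l => 1 / (1 + lam / g ^ 2) ^ (l / 2))) ∧
      ((∀ k, 0 < gapInf ι h k) →
        List.TFAE [
          ∃ lam : ℝ, 0 < lam ∧ ENNReal.ofReal lam ≤ ⨅ k, gapInf ι h k,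
          ∃ lam : ℝ, 0 < lam ∧ ConditionA r h (fun l => 1 / (1 + lam / g ^ 2) ^ (l / 2)),
          ∃ f : ℝ → ℝ, ConditionB r h f,
          ∃ s : ℕ → ℕ, IsAdmissible D s ∧ ConditionC ι h s,
          ∀ s : ℕ → ℕ, IsAdmissible D s → ConditionC ι h s]) := by
  obtain ⟨N, hN⟩ := exists_card_le hι hsep (2 * r)
  have hg : 0 < (2 : ℝ) ^ N * 2 ^ ⌈r⌉₊ := by positivity
  refine ⟨(2 : ℝ) ^ N * 2 ^ ⌈r⌉₊, hg, fun d hd h hf => ?_⟩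
  have hA : ∀ lam : ℝ, 0 < lam → ENNReal.ofReal lam ≤ ⨅ k, gapInf ι h k →
      ConditionA r h (fun l => 1 / (1 + lam / ((2 : ℝ) ^ N * 2 ^ ⌈r⌉₊) ^ 2) ^ (l / 2)) := by
    intro lam hlam hgap
    refine conditionA_of_bound hlam hg fun A B l hrl hl => ?_
    refine hf.overlap_le_rpow hr hd hN hlam (fun Λ => ?_) hrl hl
    -- Every finite region belongs to some class, so the bound over the classes controls all gaps.
    obtain ⟨k, hk⟩ := exists_mem_regionClass hD ι Λ
    exact le_gapInf_iff.mp (hgap.trans (iInf_le _ k)) Λ hk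
  refine ⟨hA, fun hpos => ?_⟩
  tfae_have 1 → 2 := fun ⟨lam, hlam, hgap⟩ => ⟨lam, hlam, hA lam hlam hgap⟩
  tfae_have 2 → 3 := fun ⟨_, _, hcond⟩ => ⟨_, hcond.conditionB⟩
  tfae_have 3 → 4 := by
    rintro ⟨f, -, ⟨C, α, hC, hα, hfl⟩, hB⟩
    exact ⟨_, isAdmissible_sq hD, hf.conditionC hr hd ι hB hC.le hα.le hfl (isAdmissible_sq hD)
      (summable_sq_div_len_rpow hD hα)⟩
  tfae_have 4 → 1 := fun ⟨_, hs, hC⟩ => hf.exists_le_iInf_gapInf hr hD hd hι hpos hs hC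
  -- Every admissible sequence requires the exponent `1`, where `∑ s_k / l_k < ∞` is exactly what is
  -- needed; Condition B with a small exponent would not give this directly.
  tfae_have 2 → 5 := by
    rintro ⟨_, _, hcond⟩ s hs
    obtain ⟨C, hC, hfl⟩ := hcond.exists_le_inv
    exact hf.conditionC hr hd ι hcond.2.2 hC.le zero_le_one hfl hs
      (by simpa only [Real.rpow_one] using hs.summable_div)
  tfae_have 5 → 4 := fun H => ⟨_, isAdmissible_sq hD, H _ (isAdmissible_sq hD)⟩
  tfae_finish
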